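/- **Setting.** Let $\mathcal A$ be a finite alphabet and $D\ge 1$; for $r\ge 0$ let $\mathbb B(r)=\{-r,\dots,r\}^D$. For $\mathfrak A\subseteq\mathcal A^{\mathbb Z^D}$ let $\mathfrak A_{(r)}=\{\mathbf c|_{\mathbb B(r)}:\mathbf c\in\mathfrak A\}$. Let $\mathfrak A$ be a subshift of finite type of radius $R$, i.e. $\mathfrak A=\{\mathbf a:\mathbf a_{\mathsf z+\mathbb B(R)}\in\mathfrak A_{(R)}\ \forall \mathsf z\in\mathbb Z^D\}$. *Unflawed regions.* For $\mathbf a\in\mathcal A^{\mathbb Z^D}$ let $\mathbb G_r(\mathbf a)=\{\mathsf z:\mathbf a_{\mathsf z+\mathbb B(r)}\in\mathfrak A_{(r)}\}$, and let $\mathbf G_r(\mathbf a)\subseteq\mathbb R^D$ be the union of all unit cubes $\mathsf z+[0,1]^D$ ($\mathsf z\in\mathbb Z^D$) all of whose corners lie in $\mathbb G_r(\mathbf a)$. Then $\mathbf G_{r+1}(\mathbf a)\subseteq \mathbf G_r(\mathbf a)$. *Tile complexes.* Let $\mathbf X_r$ be the quotient of the disjoint union of cubes $(\mathsf z,w)$,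 $\mathsf z\in\mathbb Z^D$, $w\in\mathfrak A_{(r)}$ (a copy of $\mathsf z+[0,1]^D$), obtained by gluing, for each direction $d$, the upper $d$-face of $(\mathsf z,w)$ to the lower $d$-face of $(\mathsf z+\mathsf e_d,w')$ whenever $w_{\mathsf u}=w'_{\mathsf u-\mathsf e_d}$ for all $\mathsf u$ with $\mathsf u,\mathsf u-\mathsf e_d\in\mathbb B(r)$. Let $\Pi_r:\mathbf X_r\to\mathbb R^D$ be the projection, $\zeta:\mathbf X_s\to\mathbf X_r$ ($r\le s$) the map restricting labels, and, for $\mathbf c\in\mathfrak A$, $x_r(\mathbf c)$ the corner over $0$ of the cube $(0,\mathbf c|_{\mathbb B(r)})$. Every $\mathbf a$ defines a continuous section $\varsigma^r_{\mathbf a}:\mathbf G_r(\mathbf a)\to\mathbf X_r$ of $\Pi_r$, sending the cube at $\mathsf z$ to the cube $(\mathsf z,\mathbf a_{\mathsf z+\mathbb B(r)})$. *Limit groups* (all limits over $r\ge R$). For an abelian group $G$ let $\mathcal H_k[\mathbb G_\infty(\mathbf a),G]=\varprojlim H_k(\mathbf G_r(\mathbf a),G)$, $\mathcal H_k(\mathfrak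 A,G)=\varprojlim H_k(\mathbf X_r,G)$, $\mathcal H^k[\mathbb G_\infty(\mathbf a),G]=\varinjlim H^k(\mathbf G_r(\mathbf a),G)$, $\mathcal H^k(\mathfrak A,G)=\varinjlim H^k(\mathbf X_r,G)$. A *proper base ray* for $\mathbf a$ is a continuous $\omega:[0,\infty)\to\mathbb R^D$ with $|\omega(t)|\to\infty$ such that for every $r$ we have $\omega(t)\in\mathbf G_r(\mathbf a)$ for all large $t$. For $k\ge1$, $\pi_k(\mathbf G_r(\mathbf a),\omega)$ is $\pi_k(\mathbf G_r(\mathbf a),\omega(t))$ for any $t$ such that $\omega([t,\infty))\subseteq\mathbf G_r(\mathbf a)$ (different $t$ being identified along $\omega$), and $\pi_k[\mathbb G_\infty(\mathbf a),\omega]=\varprojlim\pi_k(\mathbf G_r(\mathbf a),\omega)$. For $\mathbf c\in\mathfrak A$ let $\pi_k(\mathfrak A,\mathbf c)=\varprojlim\pi_k(\mathbf X_r,x_r(\mathbf c))$. *Basepoint-freeness.* $\mathfrak A$ is *basepoint-free in codimension $k+1$* if one of the following holds: (i) for all large $r$, $\Pi_r$ is injective on the vertices of $\mathbf X_r$ (the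 points over $\mathbb Z^D$); (ii) $(\mathfrak A,\sigma)$ is topologically weakly mixing, $k=1$, and for some $\mathbf c\in\mathfrak A$ the tower $(\pi_1(\mathbf X_r,x_r(\mathbf c)))_{r\ge R}$ is abelian; (iii) $(\mathfrak A,\sigma)$ is topologically weakly mixing and for some $\mathbf c\in\mathfrak A$ the tower $(\pi_1(\mathbf X_r,x_r(\mathbf c)))_{r\ge R}$ is trivial. Here a tower is *abelian* (*trivial*) if for every $r$ there is $s\ge r$ such that the image of the $s$-th group in the $r$-th group is abelian (trivial); for instance if all its groups are. In this case $\pi_k(\mathfrak A)$ denotes $\pi_k(\mathfrak A,\mathbf c)$ for an arbitrary $\mathbf c\in\mathfrak A$. **Theorem.** Let $\mathbf a\in\mathcal A^{\mathbb Z^D}$ be any configuration (for instance one with a defect of projective codimension $k+1$, i.e. with $\pi_k[\mathbb G_\infty(\mathbf a),\omega]$ nontrivial for some proper base ray $\omega$), and let $k\ge 0$. (a) For every abelian group $G$ there are unique homomorphisms $\mathcal H_k\mathbf a:\mathcal H_k[\mathbb G_\infty(\mathbf a),G]\to\mathcal H_k(\mathfrak A,G)$ and $\mathcal H^k\mathbf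 a:\mathcal H^k(\mathfrak A,G)\to\mathcal H^k[\mathbb G_\infty(\mathbf a),G]$ that are given for each $r\ge R$ by the homomorphisms $H_k(\varsigma^r_{\mathbf a})$ and $H^k(\varsigma^r_{\mathbf a})$. (b) Let $k\ge1$, let $\mathfrak A$ be basepoint-free in codimension $k+1$, let $\omega$ be a proper base ray for $\mathbf a$, and let $\mathbf c\in\mathfrak A$. Then there is a unique homomorphism $\pi_k\mathbf a:\pi_k[\mathbb G_\infty(\mathbf a),\omega]\to\pi_k(\mathfrak A,\mathbf c)=\pi_k(\mathfrak A)$ such that for every $r\ge R$ there is $s_0$ with the following property: for every $s\ge \max(s_0,r)$, every $t$ with $\omega([t,\infty))\subseteq\mathbf G_s(\mathbf a)$, every path $\gamma$ in $\mathbf X_s$ from $\varsigma^s_{\mathbf a}(\omega(t))$ to $x_s(\mathbf c)$, and every $\alpha$ with component $\alpha_{s,t}\in\pi_k(\mathbf G_s(\mathbf a),\omega(t))$, the change of basepoint along $\zeta\circ\gamma$ takes $(\zeta\circ\varsigma^s_{\mathbf a})_*\alpha_{s,t}$ to the component of $\pi_k\mathbf a(\alpha)$ in $\pi_k(\mathbf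 X_r,x_r(\mathbf c))$. (c) Let $\Phi:\mathcal A^{\mathbb Z^D}\to\mathcal A^{\mathbb Z^D}$ be a cellular automaton with $\Phi(\mathfrak A)\subseteq\mathfrak A$, and let $\mathbf b=\Phi(\mathbf a)$. For every radius $q$ of $\Phi$ and every $r$, we have $\mathbf G_{r+q}(\mathbf a)\subseteq\mathbf G_r(\mathbf b)$, and $\Phi$ induces a map $\Phi_*:\mathbf X_{r+q}\to\mathbf X_r$ sending the cube $(\mathsf z,\mathbf c|_{\mathbb B(r+q)})$ identically to $(\mathsf z,\Phi(\mathbf c)|_{\mathbb B(r)})$ for $\mathbf c\in\mathfrak A$. There are unique homomorphisms $\mathcal H_k\iota:\mathcal H_k[\mathbb G_\infty(\mathbf a),G]\to\mathcal H_k[\mathbb G_\infty(\mathbf b),G]$ and $\mathcal H^k\iota:\mathcal H^k[\mathbb G_\infty(\mathbf b),G]\to\mathcal H^k[\mathbb G_\infty(\mathbf a),G]$ induced by these inclusions, and unique endomorphisms $\mathcal H_k\Phi$ of $\mathcal H_k(\mathfrak A,G)$ and $\mathcal H^k\Phi$ of $\mathcal H^k(\mathfrak A,G)$ induced by these maps $\Phi_*$,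 and $$\mathcal H_k\mathbf b\circ\mathcal H_k\iota=\mathcal H_k\Phi\circ\mathcal H_k\mathbf a,\qquad \mathcal H^k\iota\circ\mathcal H^k\mathbf b=\mathcal H^k\mathbf a\circ\mathcal H^k\Phi .$$ Under the hypotheses of (b), $\omega$ is also a proper base ray for $\mathbf b$; there is a unique homomorphism $\pi_k\iota:\pi_k[\mathbb G_\infty(\mathbf a),\omega]\to\pi_k[\mathbb G_\infty(\mathbf b),\omega]$ induced by the inclusions; for all $\mathbf c,\mathbf c'\in\mathfrak A$ there is a unique homomorphism $\pi_k\Phi:\pi_k(\mathfrak A,\mathbf c)\to\pi_k(\mathfrak A,\mathbf c')$ induced by the maps $\Phi_*$ followed by changes of basepoint from $x_s(\Phi(\mathbf c))$ to $x_s(\mathbf c')$ along arbitrary paths in $\mathbf X_s$ (with $s$ large, then projected to $\mathbf X_r$, as in (b)); and $\pi_k\mathbf b\circ\pi_k\iota=\pi_k\Phi\circ\pi_k\mathbf a$. -/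

import Mathlib

open CategoryTheory
open scoped Topology unitInterval NNReal Topology.Homotopy

noncomputable section

namespace DefectSignature

/-! ### Configurations, subshifts, cellular automata -/

/-- The lattice `ℤ^D`. -/
abbrev Lat (D : ℕ) : Type := Fin D → ℤ

/-- Configurations `𝒜^{ℤ^D}`. -/
abbrev Config (A : Type) (D : ℕ) : Type := Lat D → A

/-- The shift by `v`: `(σ^v a)_z = a_{z+v}`. -/
def shift {A : Type} {D : ℕ} (v : Lat D) (a : Config A D) : Config A D := fun z => a (z + v)

/-- The box `𝔹(r) = [-r...r]^D`. -/
abbrev Box (D r : ℕ) : Type := {u : Lat D // ∀ i, |u i| ≤ (r : ℤ)}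

/-- Patterns of shape `𝔹(r)`. -/
abbrev Block (A : Type) (D r : ℕ) : Type := Box D r → A

/-- The pattern `a_{z+𝔹(r)}`, regarded as a pattern of shape `𝔹(r)`. -/
def block {A : Type} {D : ℕ} (a : Config A D) (z : Lat D) (r : ℕ) : Block A D r :=
  fun u => a (z + u.1)

/-- The set of admissible `r`-blocks of `S`. -/
def Adm {A : Type} {D : ℕ} (S : Set (Config A D)) (r : ℕ) : Set (Block A D r) :=
  (fun c => block c 0 r) '' S

/-- `S` is a subshift of finite type of radius `R`: it consists of exactly the configurations
all of whose `R`-blocks are admissible.  (Such a set is automatically closed and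
shift-invariant.) -/
def IsSFT {A : Type} {D : ℕ} (S : Set (Config A D)) (R : ℕ) : Prop :=
  S = {a | ∀ z, block a z R ∈ Adm S R}

/-- A cellular automaton: a continuous self-map of `𝒜^{ℤ^D}` commuting with all shifts. -/
structure IsCellularAutomaton {A : Type} [TopologicalSpace A] {D : ℕ}
    (Φ : Config A D → Config A D) : Prop where
  continuous : Continuous Φ
  comm : ∀ v a, Φ (shift v a) = shift v (Φ a)

/-- `Φ` has radius `q`: the value `Φ(a)_z` depends only on `a_{z+𝔹(q)}`. -/
def HasRadius {A : Type} {D : ℕ} (Φ : Config A D → Config A D) (q : ℕ) : Prop :=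
  ∀ a b z, block a z q = block b z q → Φ a z = Φ b z

/-- Topological weak mixing of `(S, σ)`: the product system `(S × S, σ × σ)` is topologically
transitive. -/
def WeaklyMixing {A : Type} [TopologicalSpace A] {D : ℕ} (S : Set (Config A D)) : Prop :=
  ∀ U V : Set (Config A D × Config A D), IsOpen U → IsOpen V →
    (U ∩ S ×ˢ S).Nonempty → (V ∩ S ×ˢ S).Nonempty →
    ∃ z : Lat D, ∃ p ∈ U ∩ S ×ˢ S, (shift z p.1, shift z p.2) ∈ V

/-! ### The unflawed region and its geometric realization -/

/-- The range-`r` unflawed region `𝔾_r(a)`: all sites around which the `r`-block of `a` is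
admissible.  Since restrictions of admissible blocks are admissible, this is the set where the
defect field `z ↦ max {r | a_{𝔹(z,r)} admissible}` is at least `r`. -/
def unflawed {A : Type} {D : ℕ} (S : Set (Config A D)) (a : Config A D) (r : ℕ) :
    Set (Lat D) :=
  {z | block a z r ∈ Adm S r}

/-- The closed unit cube with minimal corner `z`. -/
def unitCube {D : ℕ} (z : Lat D) : Set (Fin D → ℝ) :=
  {x | ∀ i, (z i : ℝ) ≤ x i ∧ x i ≤ z i + 1}

/-- The corner points of `unitCube z`. -/
def corners {D : ℕ} (z : Lat D) : Set (Lat D) := {y | ∀ i, y i = z i ∨ y i = z i + 1}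

/-- The union of all unit cubes whose corners lie in `Y`. -/
def realization {D : ℕ} (Y : Set (Lat D)) : Set (Fin D → ℝ) :=
  ⋃ z ∈ {z : Lat D | corners z ⊆ Y}, unitCube z

/-- The space `𝐆_r(a)`: the realization of the unflawed region of range `r`. -/
abbrev Unflawed {A : Type} {D : ℕ} (S : Set (Config A D)) (a : Config A D) (r : ℕ) : Type :=
  realization (unflawed S a r)

/-! ### Tile complexes -/

/-- The disjoint union of one unit cube for each site of the lattice and each tile. -/
abbrev PreComplex (D : ℕ) (W : Type) : Type := Σ p : Lat D × W, unitCube p.1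

/-- The elementary gluings.  `M d w w'` says that the upper face of `w` in direction `d` is
compatible with the lower face of `w'`.  The cubes `(z, w)` and `(z + e_d, w')` are glued along
their common face when `M d w w'` holds. -/
def Glue {D : ℕ} {W : Type} (M : Fin D → W → W → Prop) (p q : PreComplex D W) : Prop :=
  ∃ d, q.1.1 = p.1.1 + Pi.single d 1 ∧ M d p.1.2 q.1.2 ∧
    (p.2 : Fin D → ℝ) = (q.2 : Fin D → ℝ)

/-- The tile complex of a set of Wang tiles: the quotient space by the equivalence relation
generated by all gluings. -/
def TileComplex {D : ℕ} {W : Type} (M : Fin D → W → W → Prop) : Type := Quot (Glue M)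

instance {D : ℕ} {W : Type} (M : Fin D → W → W → Prop) : TopologicalSpace (TileComplex M) :=
  inferInstanceAs (TopologicalSpace (Quot (Glue M)))

/-- The point of the tile complex lying in the cube labelled `(z, w)` over `x`. -/
def TileComplex.mk {D : ℕ} {W : Type} (M : Fin D → W → W → Prop) (z : Lat D) (w : W)
    (x : unitCube z) : TileComplex M :=
  Quot.mk _ ⟨(z, w), x⟩

theorem TileComplex.continuous_mk {D : ℕ} {W : Type} (M : Fin D → W → W → Prop) (z : Lat D)
    (w : W) : Continuous (TileComplex.mk M z w) :=
  continuous_quot_mk.comp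
    (@continuous_sigmaMk (Lat D × W) (fun p => unitCube p.1) _ (z, w))

/-- The projection `Π` of the tile complex onto `ℝ^D`. -/
def TileComplex.proj {D : ℕ} {W : Type} (M : Fin D → W → W → Prop) :
    C(TileComplex M, Fin D → ℝ) where
  toFun := Quot.lift (fun p => (p.2 : Fin D → ℝ)) (fun _ _ h => h.choose_spec.2.2)
  continuous_toFun := continuous_quot_lift _
    (continuous_sigma fun _ => continuous_subtype_val)

/-- The map of tile complexes induced by a map of tiles that respects matching: the cube
`(z, w)` is mapped identically to the cube `(z, f w)`. -/
def TileComplex.map {D : ℕ} {W W' : Type} {M : Fin D → W → W → Prop}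
    {M' : Fin D → W' → W' → Prop} (f : W → W')
    (hf : ∀ d w w', M d w w' → M' d (f w) (f w')) : C(TileComplex M, TileComplex M') where
  toFun := Quot.lift (fun p => TileComplex.mk M' p.1.1 (f p.1.2) p.2) (by
    rintro p q ⟨d, h1, h2, h3⟩
    exact Quot.sound ⟨d, h1, hf d _ _ h2, h3⟩)
  continuous_toFun := continuous_quot_lift _
    (continuous_sigma fun p => TileComplex.continuous_mk M' p.1 (f p.2))

/-! ### Wang representations -/

/-- The tiles of the radius-`r` Wang representation: the admissible `r`-blocks. -/
abbrev WangTile {A : Type} {D : ℕ} (S : Set (Config A D)) (r : ℕ) : Type := Adm S r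

/-- The matching rule of the Wang representation: the restriction of `w` to the sites with
`u_d > -r` agrees with the restriction of `w'` to the sites with `u_d < r`, after translation
by `e_d`. -/
def wangMatch {A : Type} {D : ℕ} (S : Set (Config A D)) (r : ℕ) (d : Fin D)
    (w w' : WangTile S r) : Prop :=
  ∀ u v : Box D r, u.1 = v.1 + Pi.single d 1 → w.1 u = w'.1 v

/-- The tile complex `𝐗_r` of the radius-`r` Wang representation of `S`. -/
abbrev WangComplex {A : Type} {D : ℕ} (S : Set (Config A D)) (r : ℕ) : Type :=
  TileComplex (wangMatch S r)

/-- Restriction of `s`-blocks to `r`-blocks, `r ≤ s`. -/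
def restrictBlock {A : Type} {D r s : ℕ} (h : r ≤ s) (w : Block A D s) : Block A D r :=
  fun u => w ⟨u.1, fun i => (u.2 i).trans (by exact_mod_cast h)⟩

theorem restrictBlock_mem {A : Type} {D r s : ℕ} (S : Set (Config A D)) (h : r ≤ s)
    {w : Block A D s} (hw : w ∈ Adm S s) : restrictBlock h w ∈ Adm S r := by
  obtain ⟨c, hc, rfl⟩ := hw
  exact ⟨c, hc, rfl⟩

theorem unflawed_anti {A : Type} {D r s : ℕ} (S : Set (Config A D)) (a : Config A D)
    (h : r ≤ s) : unflawed S a s ⊆ unflawed S a r :=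
  fun _ hz => restrictBlock_mem S h hz

theorem realization_mono {D : ℕ} {Y Z : Set (Lat D)} (h : Y ⊆ Z) :
    realization Y ⊆ realization Z :=
  Set.biUnion_subset_biUnion_left fun _ hz => Set.Subset.trans hz h

/-- The inclusion `𝐆_s(a) ⊆ 𝐆_r(a)` for `r ≤ s`. -/
def unflawedIncl {A : Type} {D r s : ℕ} (S : Set (Config A D)) (a : Config A D) (h : r ≤ s) :
    C(Unflawed S a s, Unflawed S a r) :=
  ⟨Set.inclusion (realization_mono (unflawed_anti S a h)), continuous_inclusion _⟩

/-- The map `ζ : 𝐗_s → 𝐗_r`, `r ≤ s`, which restricts the label of every cube from an `s`-block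
to an `r`-block. -/
def zeta {A : Type} {D r s : ℕ} (S : Set (Config A D)) (h : r ≤ s) :
    C(WangComplex S s, WangComplex S r) :=
  TileComplex.map (fun w => ⟨restrictBlock h w.1, restrictBlock_mem S h w.2⟩)
    (fun _ _ _ hm u v huv => hm ⟨u.1, _⟩ ⟨v.1, _⟩ huv)

/-- The base vertex `x_r(c)` of `𝐗_r` determined by `c ∈ S`: the corner over `0` of the cube
at `0` labelled by the central `r`-block of `c`. -/
def baseVertex {A : Type} {D : ℕ} {S : Set (Config A D)} (c : S) (r : ℕ) : WangComplex S r :=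
  TileComplex.mk _ 0 ⟨block c.1 0 r, c.1, c.2, rfl⟩ ⟨0, fun i => by simp⟩

theorem zeta_baseVertex {A : Type} {D r s : ℕ} {S : Set (Config A D)} (h : r ≤ s) (c : S) :
    zeta S h (baseVertex c s) = baseVertex c r := rfl

/-! #### The section determined by a configuration -/

/-- The point over `x` in the cube at `z` labelled by the block of `a` around `z`. -/
def sectionPt {A : Type} {D r : ℕ} {S : Set (Config A D)} {a : Config A D} {x : Fin D → ℝ}
    (z : Lat D) (hz : z ∈ unflawed S a r) (hx : x ∈ unitCube z) : WangComplex S r :=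
  TileComplex.mk _ z ⟨block a z r, hz⟩ ⟨x, hx⟩

theorem sectionPt_step {A : Type} {D r : ℕ} {S : Set (Config A D)} {a : Config A D}
    {x : Fin D → ℝ} {z z' : Lat D} (d : Fin D) (h : z' = z + Pi.single d 1)
    (hz : z ∈ unflawed S a r) (hx : x ∈ unitCube z)
    (hz' : z' ∈ unflawed S a r) (hx' : x ∈ unitCube z') :
    sectionPt z hz hx = sectionPt z' hz' hx' := by
  refine Quot.sound ⟨d, h, ?_, rfl⟩
  intro u v huv
  simp only [block, h, huv]
  congr 1
  abel

theorem sectionPt_path {A : Type} {D r : ℕ} {S : Set (Config A D)} {a : Config A D}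
    {x : Fin D → ℝ} (z : Lat D) (hc : corners z ⊆ unflawed S a r) (hx : x ∈ unitCube z)
    (T : Finset (Fin D)) (hT : ∀ i ∈ T, x i = z i + 1) (z' : Lat D)
    (hz' : z' = fun i => z i + if i ∈ T then 1 else 0) :
    ∃ (hz : z ∈ unflawed S a r) (hu : z' ∈ unflawed S a r) (hx' : x ∈ unitCube z'),
      sectionPt z hz hx = sectionPt z' hu hx' := by
  have hz : z ∈ unflawed S a r := hc fun i => Or.inl rfl
  induction T using Finset.induction_on generalizing z' with
  | empty =>
    obtain rfl : z' = z := by simpa using hz'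
    exact ⟨hz, hz, hx, rfl⟩
  | insert d T hd ih =>
    obtain ⟨_, hu, hx', he⟩ := ih (fun i hi => hT i (Finset.mem_insert_of_mem hi))
      (fun i => z i + if i ∈ T then 1 else 0) rfl
    have hstep : z' = (fun i => z i + if i ∈ T then 1 else 0) + Pi.single d 1 := by
      rw [hz']
      funext i
      by_cases hi : i = d
      · subst hi
        simp [hd]
      · simp [hi]
    have hu' : z' ∈ unflawed S a r := by
      refine hc fun i => ?_
      rw [hz']
      by_cases hi : i ∈ insert d T
      · right
        simp only [hi, if_true]
      · left
        simp only [hi, if_false, add_zero]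
    have hx'' : x ∈ unitCube z' := by
      intro i
      rw [hz']
      by_cases hi : i ∈ insert d T
      · have := hT i hi
        simp only [hi, if_true]
        push_cast
        constructor <;> linarith
      · have := hx i
        simpa only [hi, if_false, add_zero] using this
    exact ⟨hz, hu', hx'', he.trans (sectionPt_step d hstep hu hx' hu' hx'')⟩

theorem sectionPt_eq {A : Type} {D r : ℕ} {S : Set (Config A D)} {a : Config A D}
    {x : Fin D → ℝ} {z z' : Lat D} (hc : corners z ⊆ unflawed S a r)
    (hc' : corners z' ⊆ unflawed S a r) (hx : x ∈ unitCube z) (hx' : x ∈ unitCube z')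
    (hz : z ∈ unflawed S a r) (hz' : z' ∈ unflawed S a r) :
    sectionPt z hz hx = sectionPt z' hz' hx' := by
  have key : ∀ (y y' : Lat D), x ∈ unitCube y → x ∈ unitCube y' →
      (∀ i ∈ Finset.univ.filter (fun i => y i < y' i), x i = y i + 1) ∧
      (fun i => max (y i) (y' i)) =
        fun i => y i + if i ∈ Finset.univ.filter (fun i => y i < y' i) then 1 else 0 := by
    intro y y' hy hy'
    have hle : ∀ i, y' i ≤ y i + 1 := fun i => by
      have h1 := (hy i).2
      have h2 := (hy' i).1
      exact_mod_cast h2.trans h1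
    refine ⟨fun i hi => ?_, ?_⟩
    · have hlt : y i < y' i := by simpa using hi
      have : (y i : ℝ) + 1 ≤ y' i := by exact_mod_cast hlt
      exact le_antisymm (hy i).2 (this.trans (hy' i).1)
    · funext i
      by_cases hlt : y i < y' i
      · have := hle i
        simp only [Finset.mem_filter, Finset.mem_univ, true_and, hlt, if_true]
        omega
      · simp only [Finset.mem_filter, Finset.mem_univ, true_and, hlt, if_false]
        omega
  obtain ⟨h1, h2⟩ := key z z' hx hx'
  obtain ⟨h1', h2'⟩ := key z' z hx' hx
  have hmax : (fun i => max (z i) (z' i)) = fun i => max (z' i) (z i) := by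
    funext i
    exact max_comm _ _
  obtain ⟨_, _, _, e⟩ := sectionPt_path z hc hx _ h1 _ h2
  obtain ⟨_, _, _, e'⟩ := sectionPt_path z' hc' hx' _ h1' _ (hmax.trans h2')
  exact e.trans e'.symm

theorem locallyFinite_unitCube {D : ℕ} : LocallyFinite fun z : Lat D => unitCube z := by
  intro x
  refine ⟨Metric.ball x 1, Metric.ball_mem_nhds x one_pos, ?_⟩
  refine (Set.Finite.pi' fun i : Fin D =>
    Set.finite_Icc (⌊x i⌋ - 3) (⌊x i⌋ + 3)).subset ?_
  rintro z ⟨y, hy, hyx⟩ i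
  have h1 : |y i - x i| < 1 := by
    have := (dist_le_pi_dist y x i).trans_lt hyx
    rwa [Real.dist_eq] at this
  have h2 := hy i
  have h3 := Int.floor_le (x i)
  have h4 := Int.lt_floor_add_one (x i)
  rw [abs_lt] at h1
  constructor
  · have : ((⌊x i⌋ - 3 : ℤ) : ℝ) ≤ z i := by push_cast; linarith
    exact_mod_cast this
  · have : (z i : ℝ) ≤ ((⌊x i⌋ + 3 : ℤ) : ℝ) := by push_cast; linarith
    exact_mod_cast this

theorem isClosed_unitCube {D : ℕ} (z : Lat D) : IsClosed (unitCube z) := by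
  have : unitCube z = ⋂ i, {x : Fin D → ℝ | (z i : ℝ) ≤ x i ∧ x i ≤ z i + 1} := by
    ext x
    simp [unitCube]
  rw [this]
  exact isClosed_iInter fun i =>
    (isClosed_le continuous_const (continuous_apply i)).inter
      (isClosed_le (continuous_apply i) continuous_const)

theorem exists_cube {D : ℕ} {Y : Set (Lat D)} (x : realization Y) :
    ∃ z : Lat D, corners z ⊆ Y ∧ x.1 ∈ unitCube z := by
  have := x.2
  simp only [realization, Set.mem_iUnion, Set.mem_ofPred_eq] at this
  obtain ⟨z, h1, h2⟩ := this
  exact ⟨z, h1, h2⟩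

/-- The underlying function of the section `ς^r_a`. -/
def sectionFun {A : Type} {D : ℕ} (S : Set (Config A D)) (a : Config A D) (r : ℕ)
    (x : Unflawed S a r) : WangComplex S r :=
  sectionPt (exists_cube x).choose ((exists_cube x).choose_spec.1 fun _ => Or.inl rfl)
    (exists_cube x).choose_spec.2

/-- On the cube at `z`, the section takes values in the cube labelled by the block of `a`
around `z`. -/
theorem sectionFun_eq {A : Type} {D : ℕ} (S : Set (Config A D)) (a : Config A D) (r : ℕ)
    (x : Unflawed S a r) (z : Lat D) (hc : corners z ⊆ unflawed S a r)
    (hz : z ∈ unflawed S a r) (hx : x.1 ∈ unitCube z) :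
    sectionFun S a r x = TileComplex.mk _ z ⟨block a z r, hz⟩ ⟨x.1, hx⟩ :=
  sectionPt_eq (exists_cube x).choose_spec.1 hc _ hx _ hz

theorem continuous_sectionFun {A : Type} {D : ℕ} (S : Set (Config A D)) (a : Config A D)
    (r : ℕ) : Continuous (sectionFun S a r) := by
  let F : {z : Lat D // corners z ⊆ unflawed S a r} → Set (Unflawed S a r) :=
    fun z => Subtype.val ⁻¹' unitCube z.1
  have hF : LocallyFinite F :=
    (locallyFinite_unitCube.comp_injective Subtype.val_injective).preimage_continuous
      continuous_subtype_val
  refine hF.continuous ?_ (fun z => (isClosed_unitCube z.1).preimage continuous_subtype_val) ?_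
  · refine Set.eq_univ_of_forall fun x => ?_
    obtain ⟨z, h1, h2⟩ := exists_cube x
    exact Set.mem_iUnion.2 ⟨⟨z, h1⟩, h2⟩
  · intro z
    rw [continuousOn_iff_continuous_domRestrict]
    have hz : z.1 ∈ unflawed S a r := z.2 fun _ => Or.inl rfl
    have : (F z).domRestrict (sectionFun S a r) = fun x : F z =>
        TileComplex.mk (wangMatch S r) z.1 ⟨block a z.1 r, hz⟩ ⟨x.1.1, x.2⟩ := by
      funext x
      exact sectionFun_eq S a r x.1 z.1 z.2 hz x.2
    rw [this]
    exact (TileComplex.continuous_mk _ _ _).comp (by fun_prop)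

/-- The continuous section `ς^r_a : 𝐆_r(a) → 𝐗_r` determined by the configuration `a`. -/
def sec {A : Type} {D : ℕ} (S : Set (Config A D)) (a : Config A D) (r : ℕ) :
    C(Unflawed S a r, WangComplex S r) :=
  ⟨sectionFun S a r, continuous_sectionFun S a r⟩

/-! ### Maps induced by a cellular automaton -/

theorem IsCellularAutomaton.image_block {A : Type} [TopologicalSpace A] {D : ℕ}
    {Φ : Config A D → Config A D} (hΦ : IsCellularAutomaton Φ) {q r : ℕ} (hq : HasRadius Φ q)
    {a b : Config A D} {z y : Lat D} {u v : Lat D} (hu : ∀ i, |u i| ≤ (r : ℤ))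
    (hv : ∀ i, |v i| ≤ (r : ℤ))
    (h : ∀ (s t : Box D (r + q)), s.1 - u = t.1 - v → a (z + s.1) = b (y + t.1)) :
    Φ a (z + u) = Φ b (y + v) := by
  have e1 : Φ a (z + u) = Φ (shift (z + u) a) 0 := by
    rw [hΦ.comm]
    simp [shift]
  have e2 : Φ b (y + v) = Φ (shift (y + v) b) 0 := by
    rw [hΦ.comm]
    simp [shift]
  rw [e1, e2]
  apply hq
  funext w
  have hb : ∀ t : Lat D, (∀ i, |t i| ≤ (r : ℤ)) → ∀ i, |(t + w.1) i| ≤ ((r + q : ℕ) : ℤ) := by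
    intro t ht i
    push_cast
    exact (abs_add_le _ _).trans (add_le_add (ht i) (w.2 i))
  have := h ⟨u + w.1, hb u hu⟩ ⟨v + w.1, hb v hv⟩ (by simp)
  simp only [block, shift, zero_add]
  rwa [show w.1 + (z + u) = z + (u + w.1) by abel, show w.1 + (y + v) = y + (v + w.1) by abel]

/-- The `r`-block of `Φ(a)` around `z` is determined by the `(r+q)`-block of `a` around `z`. -/
theorem IsCellularAutomaton.block_eq {A : Type} [TopologicalSpace A] {D : ℕ}
    {Φ : Config A D → Config A D} (hΦ : IsCellularAutomaton Φ) {q : ℕ} (hq : HasRadius Φ q)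
    (r : ℕ) {a b : Config A D} {z y : Lat D} (h : block a z (r + q) = block b y (r + q)) :
    block (Φ a) z r = block (Φ b) y r := by
  funext u
  refine hΦ.image_block hq u.2 u.2 fun s t hst => ?_
  obtain rfl : s = t := Subtype.ext (sub_left_injective hst)
  exact congrFun h s

/-- The map on tiles induced by `Φ`: the central `(r+q)`-block of `c ∈ S` is sent to the central
`r`-block of `Φ(c)`. -/
def tileMap {A : Type} {D : ℕ} {S : Set (Config A D)} {Φ : Config A D → Config A D}
    (hS : Set.MapsTo Φ S S) (q r : ℕ) (w : WangTile S (r + q)) : WangTile S r :=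
  ⟨block (Φ w.2.choose) 0 r, Φ w.2.choose, hS w.2.choose_spec.1, rfl⟩

theorem tileMap_block {A : Type} [TopologicalSpace A] {D : ℕ} {S : Set (Config A D)}
    {Φ : Config A D → Config A D} (hΦ : IsCellularAutomaton Φ) (hS : Set.MapsTo Φ S S) {q : ℕ}
    (hq : HasRadius Φ q) (r : ℕ) (c : S) :
    tileMap hS q r ⟨block c.1 0 (r + q), c.1, c.2, rfl⟩ =
      ⟨block (Φ c.1) 0 r, Φ c.1, hS c.2, rfl⟩ := by
  refine Subtype.ext (hΦ.block_eq hq r ?_)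
  exact (⟨c.1, c.2, rfl⟩ : block c.1 0 (r + q) ∈ Adm S (r + q)).choose_spec.2

/-- The map `Φ_* : 𝐗_{r+q} → 𝐗_r` induced by a cellular automaton of radius `q`. -/
def wangMap {A : Type} [TopologicalSpace A] {D : ℕ} {S : Set (Config A D)}
    {Φ : Config A D → Config A D} (hΦ : IsCellularAutomaton Φ) (hS : Set.MapsTo Φ S S) {q : ℕ}
    (hq : HasRadius Φ q) (r : ℕ) : C(WangComplex S (r + q), WangComplex S r) :=
  TileComplex.map (tileMap hS q r) (by
    intro d w w' hm u v huv
    refine hΦ.image_block hq u.2 v.2 fun s t hst => ?_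
    have hs : s.1 = t.1 + Pi.single d 1 := by
      rw [huv] at hst
      have h2 : s.1 = t.1 - v.1 + (v.1 + Pi.single d 1) := sub_eq_iff_eq_add.1 hst
      rw [h2]
      abel
    have := hm s t hs
    have h1 := congrFun w.2.choose_spec.2 s
    have h2 := congrFun w'.2.choose_spec.2 t
    exact h1.trans (this.trans h2.symm))

theorem wangMap_baseVertex {A : Type} [TopologicalSpace A] {D : ℕ} {S : Set (Config A D)}
    {Φ : Config A D → Config A D} (hΦ : IsCellularAutomaton Φ) (hS : Set.MapsTo Φ S S) {q : ℕ}
    (hq : HasRadius Φ q) (r : ℕ) (c : S) :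
    wangMap hΦ hS hq r (baseVertex c (r + q)) = baseVertex ⟨Φ c.1, hS c.2⟩ r :=
  congrArg (fun w => TileComplex.mk (wangMatch S r) 0 w ⟨0, fun i => by simp⟩)
    (tileMap_block hΦ hS hq r c)

theorem unflawed_subset {A : Type} [TopologicalSpace A] {D : ℕ} {S : Set (Config A D)}
    {Φ : Config A D → Config A D} (hΦ : IsCellularAutomaton Φ) (hS : Set.MapsTo Φ S S) {q : ℕ}
    (hq : HasRadius Φ q) (a : Config A D) (r : ℕ) :
    unflawed S a (r + q) ⊆ unflawed S (Φ a) r := by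
  rintro z ⟨c, hc, he⟩
  exact ⟨Φ c, hS hc, hΦ.block_eq hq r he⟩

/-- The inclusion `ι : 𝐆_{r+q}(a) ⊆ 𝐆_r(Φ(a))`. -/
def defectIncl {A : Type} [TopologicalSpace A] {D : ℕ} {S : Set (Config A D)}
    {Φ : Config A D → Config A D} (hΦ : IsCellularAutomaton Φ) (hS : Set.MapsTo Φ S S) {q : ℕ}
    (hq : HasRadius Φ q) (a : Config A D) (r : ℕ) :
    C(Unflawed S a (r + q), Unflawed S (Φ a) r) :=
  ⟨Set.inclusion (realization_mono (unflawed_subset hΦ hS hq a r)), continuous_inclusion _⟩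

/-! ### Homology and cohomology with coefficients -/

section Homology

universe u

/-- Singular homology `H_k(-; G)`. -/
def homologyFunctor (G : Type u) [AddCommGroup G] (k : ℕ) : TopCat.{0} ⥤ AddCommGrpCat.{u} :=
  (AlgebraicTopology.singularHomologyFunctor.{0} AddCommGrpCat.{u} k).obj (AddCommGrpCat.of G)

/-- Singular cohomology `H^k(-; G)`: the cohomology of the complex `Hom(C_•(-; ℤ), G)`. -/
def cohomologyFunctor (G : Type u) [AddCommGroup G] (k : ℕ) :
    TopCat.{0}ᵒᵖ ⥤ AddCommGrpCat.{u} :=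
  ((AlgebraicTopology.singularChainComplexFunctor.{0} AddCommGrpCat.{u}).obj
      (AddCommGrpCat.of (ULift.{u} ℤ))).op ⋙
    HomologicalComplex.opFunctor _ _ ⋙
    (preadditiveYoneda.obj (AddCommGrpCat.of G)).mapHomologicalComplex _ ⋙
    HomologicalComplex.homologyFunctor _ _ k

/-- The homology group `H_k(X; G)`. -/
abbrev Homology (G : Type u) [AddCommGroup G] (k : ℕ) (X : Type) [TopologicalSpace X] : Type u :=
  (homologyFunctor G k).obj (TopCat.of X)

/-- The homomorphism `H_k(X; G) → H_k(Y; G)` induced by a continuous map. -/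
def homologyMap (G : Type u) [AddCommGroup G] (k : ℕ) {X Y : Type} [TopologicalSpace X]
    [TopologicalSpace Y] (f : C(X, Y)) : Homology G k X →+ Homology G k Y :=
  ((homologyFunctor G k).map (TopCat.ofHom f)).hom

/-- The cohomology group `H^k(X; G)`. -/
abbrev Cohomology (G : Type u) [AddCommGroup G] (k : ℕ) (X : Type) [TopologicalSpace X] :
    Type u :=
  (cohomologyFunctor G k).obj (Opposite.op (TopCat.of X))

/-- The homomorphism `H^k(Y; G) → H^k(X; G)` induced by a continuous map `X → Y`. -/
def cohomologyMap (G : Type u) [AddCommGroup G] (k : ℕ) {X Y : Type} [TopologicalSpace X]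
    [TopologicalSpace Y] (f : C(X, Y)) : Cohomology G k Y →+ Cohomology G k X :=
  ((cohomologyFunctor G k).map (TopCat.ofHom f).op).hom

/-- The inverse limit of an inverse system of abelian groups. -/
def invLim {ι : Type} [Preorder ι] (H : ι → Type u) [∀ i, AddCommGroup (H i)]
    (f : ∀ i j, i ≤ j → H j →+ H i) : AddSubgroup (∀ i, H i) where
  carrier := {x | ∀ i j (h : i ≤ j), f i j h (x j) = x i}
  zero_mem' := fun _ _ _ => by simp
  add_mem' := fun hx hy i j h => by simp [hx i j h, hy i j h]
  neg_mem' := fun hx i j h => by simp [hx i j h]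

variable {A : Type} {D : ℕ} (S : Set (Config A D)) (R : ℕ) (a : Config A D)
  (G : Type u) [AddCommGroup G] (k : ℕ)

/-- `H_k[𝔾_∞(a); G]`, the inverse limit of the groups `H_k(𝐆_r(a); G)`, `r ≥ R`. -/
abbrev DefectHomology : Type u :=
  invLim (fun r : Set.Ici R => Homology G k (Unflawed S a r))
    (fun _ _ h => homologyMap G k (unflawedIncl S a h))

/-- `H_k(S; G)`, the inverse limit of the groups `H_k(𝐗_r; G)`, `r ≥ R`. -/
abbrev ShiftHomology : Type u :=
  invLim (fun r : Set.Ici R => Homology G k (WangComplex S r))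
    (fun _ _ h => homologyMap G k (zeta S h))

/-- `H^k[𝔾_∞(a); G]`, the direct limit of the groups `H^k(𝐆_r(a); G)`, `r ≥ R`. -/
abbrev DefectCohomology : Type u :=
  AddCommGroup.DirectLimit (fun r : Set.Ici R => Cohomology G k (Unflawed S a r))
    (fun _ _ h => cohomologyMap G k (unflawedIncl S a h))

/-- `H^k(S; G)`, the direct limit of the groups `H^k(𝐗_r; G)`, `r ≥ R`. -/
abbrev ShiftCohomology : Type u :=
  AddCommGroup.DirectLimit (fun r : Set.Ici R => Cohomology G k (WangComplex S r))
    (fun _ _ h => cohomologyMap G k (zeta S h))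

/-- The canonical map `H^k(𝐆_r(a); G) → H^k[𝔾_∞(a); G]`. -/
def DefectCohomology.of (r : Set.Ici R) :
    Cohomology G k (Unflawed S a r) →+ DefectCohomology S R a G k :=
  AddCommGroup.DirectLimit.of (fun r : Set.Ici R => Cohomology G k (Unflawed S a r))
    (fun _ _ h => cohomologyMap G k (unflawedIncl S a h)) r

/-- The canonical map `H^k(𝐗_r; G) → H^k(S; G)`. -/
def ShiftCohomology.of (r : Set.Ici R) :
    Cohomology G k (WangComplex S r) →+ ShiftCohomology S R G k :=
  AddCommGroup.DirectLimit.of (fun r : Set.Ici R => Cohomology G k (WangComplex S r))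
    (fun _ _ h => cohomologyMap G k (zeta S h)) r

variable {S R a G k}

/-- `f` is the homology signature of `a`: in each range `r` it is induced by the section
`ς^r_a`. -/
def IsHomologySignature (f : DefectHomology S R a G k →+ ShiftHomology S R G k) : Prop :=
  ∀ (x : DefectHomology S R a G k) (r : Set.Ici R),
    (f x).1 r = homologyMap G k (sec S a r) (x.1 r)

/-- `f` is the cohomology signature of `a`: in each range `r` it is induced by the section
`ς^r_a`. -/
def IsCohomologySignature (f : ShiftCohomology S R G k →+ DefectCohomology S R a G k) : Prop :=
  ∀ (r : Set.Ici R) (x : Cohomology G k (WangComplex S r)),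
    f (ShiftCohomology.of S R G k r x) =
      DefectCohomology.of S R a G k r (cohomologyMap G k (sec S a r) x)

/-- The index `r + q`. -/
def addIdx (r : Set.Ici R) (q : ℕ) : Set.Ici R :=
  ⟨r.1 + q, le_trans (show R ≤ r.1 from r.2) (Nat.le_add_right _ _)⟩

variable [TopologicalSpace A] {Φ : Config A D → Config A D}

/-- `f = H_k ι`: in each range it is induced by the inclusion `𝐆_{r+q}(a) ⊆ 𝐆_r(Φ(a))`,
where `q` is any radius of `Φ`. -/
def IsHomologyInclusion (hΦ : IsCellularAutomaton Φ) (hS : Set.MapsTo Φ S S)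
    (f : DefectHomology S R a G k →+ DefectHomology S R (Φ a) G k) : Prop :=
  ∀ (q : ℕ) (hq : HasRadius Φ q) (x : DefectHomology S R a G k) (r : Set.Ici R),
    (f x).1 r = homologyMap G k (defectIncl hΦ hS hq a r) (x.1 (addIdx r q))

/-- `f = H_k Φ`: in each range it is induced by `Φ_* : 𝐗_{r+q} → 𝐗_r`, where `q` is any radius
of `Φ`. -/
def IsHomologyCAMap (hΦ : IsCellularAutomaton Φ) (hS : Set.MapsTo Φ S S)
    (f : ShiftHomology S R G k →+ ShiftHomology S R G k) : Prop :=
  ∀ (q : ℕ) (hq : HasRadius Φ q) (x : ShiftHomology S R G k) (r : Set.Ici R),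
    (f x).1 r = homologyMap G k (wangMap hΦ hS hq r) (x.1 (addIdx r q))

/-- `f = H^k ι`: in each range it is induced by the inclusion `𝐆_{r+q}(a) ⊆ 𝐆_r(Φ(a))`. -/
def IsCohomologyInclusion (hΦ : IsCellularAutomaton Φ) (hS : Set.MapsTo Φ S S)
    (f : DefectCohomology S R (Φ a) G k →+ DefectCohomology S R a G k) : Prop :=
  ∀ (q : ℕ) (hq : HasRadius Φ q) (r : Set.Ici R) (x : Cohomology G k (Unflawed S (Φ a) r)),
    f (DefectCohomology.of S R (Φ a) G k r x) =
      DefectCohomology.of S R a G k (addIdx r q)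
        (cohomologyMap G k (defectIncl hΦ hS hq a r) x)

/-- `f = H^k Φ`: in each range it is induced by `Φ_* : 𝐗_{r+q} → 𝐗_r`. -/
def IsCohomologyCAMap (hΦ : IsCellularAutomaton Φ) (hS : Set.MapsTo Φ S S)
    (f : ShiftCohomology S R G k →+ ShiftCohomology S R G k) : Prop :=
  ∀ (q : ℕ) (hq : HasRadius Φ q) (r : Set.Ici R) (x : Cohomology G k (WangComplex S r)),
    f (ShiftCohomology.of S R G k r x) =
      ShiftCohomology.of S R G k (addIdx r q) (cohomologyMap G k (wangMap hΦ hS hq r) x)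

end Homology

/-! ### Homotopy groups -/

section Homotopy

/-- The class in `π_k(X, x)` of a map from the `k`-cube that sends the boundary to `x`. -/
def piMk {k : ℕ} {X : Type} [TopologicalSpace X] {x : X} (p : Ω^ (Fin k) X x) : π_ k X x :=
  Quotient.mk _ p

theorem piMk_mul {k : ℕ} [NeZero k] {X : Type} [TopologicalSpace X] {x : X} (i : Fin k)
    (p q : Ω^ (Fin k) X x) : piMk p * piMk q = piMk (GenLoop.transAt i q p) :=
  HomotopyGroup.mul_spec

theorem piMk_inv {k : ℕ} [NeZero k] {X : Type} [TopologicalSpace X] {x : X} (i : Fin k)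
    (p : Ω^ (Fin k) X x) : (piMk p)⁻¹ = piMk (GenLoop.symmAt i p) :=
  HomotopyGroup.inv_spec

theorem piMk_one {k : ℕ} [NeZero k] {X : Type} [TopologicalSpace X] {x : X} :
    (1 : π_ k X x) = piMk GenLoop.const :=
  HomotopyGroup.one_def

/-- The map on generalized loops induced by a continuous map. -/
def genLoopMap {N X Y : Type} [TopologicalSpace X] [TopologicalSpace Y] (f : C(X, Y))
    {x : X} {y : Y} (h : f x = y) (p : Ω^ N X x) : Ω^ N Y y :=
  ⟨f.comp p.1, fun u hu => (congrArg f (p.2 u hu)).trans h⟩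

/-- The homomorphism `π_k(X, x) → π_k(Y, y)` induced by a continuous map `f` with `f x = y`. -/
def piMap (k : ℕ) [NeZero k] {X Y : Type} [TopologicalSpace X] [TopologicalSpace Y] (f : C(X, Y))
    {x : X} {y : Y} (h : f x = y) : π_ k X x →* π_ k Y y :=
  MonoidHom.mk'
    (Quotient.map (genLoopMap f h) (fun _ _ H => H.map fun H => H.compContinuousMap f))
    (by
      rintro ⟨p⟩ ⟨q⟩
      have i : Fin k := ⟨0, Nat.pos_of_neZero k⟩
      have e3 : genLoopMap f h (GenLoop.transAt i q p) =
          GenLoop.transAt i (genLoopMap f h q) (genLoopMap f h p) := by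
        apply GenLoop.ext
        intro u
        show f (ite _ _ _) = ite _ _ _
        rw [apply_ite f]
        rfl
      change Quotient.map _ _ (piMk p * piMk q) =
        piMk (genLoopMap f h p) * piMk (genLoopMap f h q)
      rw [piMk_mul i, piMk_mul i, ← e3]
      rfl)

/-- `Transports γ α β`: the change-of-basepoint isomorphism along the path `γ` takes
`α ∈ π_k(X, x)` to `β ∈ π_k(X, y)`, i.e. there is a free homotopy from a representative of `α`
to a representative of `β` during which the boundary of the cube (that is, the basepoint of the
sphere) moves along `γ`. -/
def Transports {k : ℕ} {X : Type} [TopologicalSpace X] {x y : X} (γ : I → X)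
    (α : π_ k X x) (β : π_ k X y) : Prop :=
  ∃ (p : Ω^ (Fin k) X x) (q : Ω^ (Fin k) X y) (H : C(I × (I^ Fin k), X)),
    α = piMk p ∧ β = piMk q ∧
    (∀ u, H (0, u) = p u) ∧ (∀ u, H (1, u) = q u) ∧
    ∀ s, ∀ u ∈ Cube.boundary (Fin k), H (s, u) = γ s

theorem Transports.one {k : ℕ} [NeZero k] {X : Type} [TopologicalSpace X] {x y : X} {γ : I → X}
    (hγ : Continuous γ) (h0 : γ 0 = x) (h1 : γ 1 = y) :
    Transports γ (1 : π_ k X x) (1 : π_ k X y) :=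
  ⟨GenLoop.const, GenLoop.const, ⟨fun z => γ z.1, hγ.comp continuous_fst⟩, piMk_one, piMk_one,
    fun _ => h0, fun _ => h1, fun _ _ _ => rfl⟩

theorem Transports.inv {k : ℕ} [NeZero k] {X : Type} [TopologicalSpace X] {x y : X} {γ : I → X}
    {α : π_ k X x} {β : π_ k X y} (h : Transports γ α β) : Transports γ α⁻¹ β⁻¹ := by
  obtain ⟨p, q, H, rfl, rfl, h0, h1, hb⟩ := h
  have i : Fin k := ⟨0, Nat.pos_of_neZero k⟩
  refine ⟨GenLoop.symmAt i p, GenLoop.symmAt i q,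
    ⟨fun z => H (z.1, fun j => if j = i then unitInterval.symm (z.2 i) else z.2 j), ?_⟩,
    piMk_inv i p, piMk_inv i q, fun u => h0 _, fun u => h1 _, ?_⟩
  · refine H.continuous.comp (continuous_fst.prodMk (continuous_pi fun j => ?_))
    by_cases hj : j = i
    · simp only [hj, if_true]
      fun_prop
    · simp only [hj, if_false]
      fun_prop
  · rintro s u ⟨j, hj⟩
    refine hb s _ ⟨j, ?_⟩
    by_cases hji : j = i
    · subst hji
      simp only [if_true]
      rcases hj with hj | hj
      · right
        simp [hj]
      · left
        simp [hj]
    · simpa only [hji, if_false] using hj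

theorem Transports.mul {k : ℕ} [NeZero k] {X : Type} [TopologicalSpace X] {x y : X} {γ : I → X}
    {α α' : π_ k X x} {β β' : π_ k X y} (h : Transports γ α β) (h' : Transports γ α' β') :
    Transports γ (α * α') (β * β') := by
  obtain ⟨p, q, H, rfl, rfl, h0, h1, hb⟩ := h
  obtain ⟨p', q', H', rfl, rfl, h0', h1', hb'⟩ := h'
  have i : Fin k := ⟨0, Nat.pos_of_neZero k⟩
  refine ⟨GenLoop.transAt i p' p, GenLoop.transAt i q' q,
    ⟨fun z => if (z.2 i : ℝ) ≤ 1 / 2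
      then H' (z.1, Function.update z.2 i (Set.projIcc 0 1 zero_le_one (2 * (z.2 i : ℝ))))
      else H (z.1, Function.update z.2 i (Set.projIcc 0 1 zero_le_one (2 * (z.2 i : ℝ) - 1))),
      ?_⟩,
    piMk_mul i p p', piMk_mul i q q', fun u => ?_, fun u => ?_, ?_⟩
  · refine Continuous.if_le ?_ ?_ (by fun_prop) continuous_const ?_
    · refine H'.continuous.comp (continuous_fst.prodMk (continuous_snd.update i ?_))
      exact continuous_projIcc.comp (by fun_prop)
    · refine H.continuous.comp (continuous_fst.prodMk (continuous_snd.update i ?_))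
      exact continuous_projIcc.comp (by fun_prop)
    · intro z hz
      rw [hz, hb' _ _ ⟨i, Or.inr ?_⟩, hb _ _ ⟨i, Or.inl ?_⟩]
      · rw [Function.update_self]
        norm_num
      · rw [Function.update_self]
        norm_num
  · show ite _ _ _ = ite _ _ _
    rw [h0, h0']
  · show ite _ _ _ = ite _ _ _
    rw [h1, h1']
  · rintro s u ⟨j, hj⟩
    show (if (u i : ℝ) ≤ 1 / 2
      then H' (s, Function.update u i (Set.projIcc 0 1 zero_le_one (2 * (u i : ℝ))))
      else H (s, Function.update u i (Set.projIcc 0 1 zero_le_one (2 * (u i : ℝ) - 1)))) = γ s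
    by_cases hji : j = i
    · subst hji
      rcases hj with hj | hj
      · rw [if_pos (by rw [hj]; norm_num)]
        refine hb' s _ ⟨j, Or.inl ?_⟩
        rw [Function.update_self, hj]
        norm_num
      · rw [if_neg (by rw [hj]; norm_num)]
        refine hb s _ ⟨j, Or.inr ?_⟩
        rw [Function.update_self, hj]
        norm_num
    · split_ifs
      · refine hb' s _ ⟨j, ?_⟩
        rwa [Function.update_of_ne hji]
      · refine hb s _ ⟨j, ?_⟩
        rwa [Function.update_of_ne hji]

variable {A : Type} {D : ℕ} (S : Set (Config A D)) (R : ℕ) (a : Config A D) (k : ℕ)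

/-! #### The homotopy groups of a subshift of finite type -/

/-- `π_k(S, c)`: the inverse limit of the groups `π_k(𝐗_r, x_r(c))`, `r ≥ R`. -/
def ShiftHomotopy [NeZero k] (c : S) :
    Subgroup (∀ r : Set.Ici R, π_ k (WangComplex S r) (baseVertex c r)) where
  carrier := {x | ∀ (r s : Set.Ici R) (h : r ≤ s),
    piMap k (zeta S h) (zeta_baseVertex h c) (x s) = x r}
  one_mem' := fun _ _ _ => by simp
  mul_mem' := fun hx hy r s h => by simp [hx r s h, hy r s h]
  inv_mem' := fun hx r s h => by simp [hx r s h]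

/-- Every vertex of the lattice has at most one vertex of `𝐗_r` above it, i.e. the projection
of the `0`-skeleton of `𝐗_r` to `ℤ^D` is injective. -/
def VertexInjective (r : ℕ) : Prop :=
  ∀ (x y : WangComplex S r) (z : Lat D), TileComplex.proj _ x = (fun i => (z i : ℝ)) →
    TileComplex.proj _ y = (fun i => (z i : ℝ)) → x = y

/-- The tower of fundamental groups `π_1(𝐗_r, x_r(c))`, `r ≥ R`, is abelian (as a pro-group):
for every `r` there is `s ≥ r` such that the image of `π_1(𝐗_s)` in `π_1(𝐗_r)` is abelian.
This holds in particular when all the groups `π_1(𝐗_r, x_r(c))` are abelian. -/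
def FundamentalTowerAbelian (c : S) : Prop :=
  ∀ r : Set.Ici R, ∃ (s : Set.Ici R) (h : r ≤ s),
    ∀ g g' : π_ 1 (WangComplex S s) (baseVertex c s),
      piMap 1 (zeta S h) (zeta_baseVertex h c) (g * g') =
        piMap 1 (zeta S h) (zeta_baseVertex h c) (g' * g)

/-- The tower of fundamental groups `π_1(𝐗_r, x_r(c))`, `r ≥ R`, is trivial (as a pro-group):
for every `r` there is `s ≥ r` such that the image of `π_1(𝐗_s)` in `π_1(𝐗_r)` is trivial.
This holds in particular when all the groups `π_1(𝐗_r, x_r(c))` are trivial. -/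
def FundamentalTowerTrivial (c : S) : Prop :=
  ∀ r : Set.Ici R, ∃ (s : Set.Ici R) (h : r ≤ s),
    ∀ g : π_ 1 (WangComplex S s) (baseVertex c s),
      piMap 1 (zeta S h) (zeta_baseVertex h c) g = 1

/-- `S` is basepoint-free in codimension `k + 1`. -/
def BasepointFree [TopologicalSpace A] : Prop :=
  (∃ r₀, ∀ r ≥ r₀, VertexInjective S r) ∨
  (WeaklyMixing S ∧ k = 1 ∧ ∃ c : S, FundamentalTowerAbelian S R c) ∨
  (WeaklyMixing S ∧ ∃ c : S, FundamentalTowerTrivial S R c)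

/-! #### The proper homotopy groups of the unflawed regions -/

/-- A proper base ray for `a`: a continuous path in `ℝ^D` that tends to infinity and that, for
every `r`, eventually stays in `𝐆_r(a)`. -/
structure IsBaseRay (ω : ℝ≥0 → Fin D → ℝ) : Prop where
  continuous : Continuous ω
  tendsto : Filter.Tendsto (fun t => ‖ω t‖) Filter.atTop Filter.atTop
  eventually : ∀ r : ℕ, ∀ᶠ t in Filter.atTop, ω t ∈ realization (unflawed S a r)

/-- The ray `ω` stays in `𝐆_r(a)` from time `t` on. -/
def StaysFrom (ω : ℝ≥0 → Fin D → ℝ) (r : ℕ) (t : ℝ≥0) : Prop :=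
  ∀ t' ≥ t, ω t' ∈ realization (unflawed S a r)

/-- The point `ω(t)` of `𝐆_r(a)`. -/
def rayPt {S : Set (Config A D)} {a : Config A D} {ω : ℝ≥0 → Fin D → ℝ} {r : ℕ} {t : ℝ≥0}
    (h : StaysFrom S a ω r t) : Unflawed S a r :=
  ⟨ω t, h t le_rfl⟩

/-- The segment of the ray `ω` from `ω(t)` to `ω(t')`, as a path in `𝐆_r(a)`. -/
def raySegment {S : Set (Config A D)} {a : Config A D} {ω : ℝ≥0 → Fin D → ℝ} {r : ℕ} {t : ℝ≥0}
    (h : StaysFrom S a ω r t) (t' : ℝ≥0) (u : I) : Unflawed S a r :=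
  ⟨ω (t + unitInterval.toNNReal u * (t' - t)), h _ le_self_add⟩

/-- Pairs `(r, t)` such that `r ≥ R` and the ray stays in `𝐆_r(a)` from time `t` on. -/
structure RayIndex (ω : ℝ≥0 → Fin D → ℝ) where
  /-- the range -/
  r : Set.Ici R
  /-- the time -/
  t : ℝ≥0
  stays : StaysFrom S a ω r t

/-- `π_k[𝔾_∞(a), ω]`: the inverse limit of the groups `π_k(𝐆_r(a), ω)`, `r ≥ R`.  The group
`π_k(𝐆_r(a), ω)` is `π_k(𝐆_r(a), ω(t))` for any `t` such that `ω` stays in `𝐆_r(a)` from time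
`t` on, where the groups for different `t` are identified by moving the basepoint along `ω`.
Thus an element is a family of `α_{r,t} ∈ π_k(𝐆_r(a), ω(t))` such that, for `r ≤ s` and
`t ≤ t'`, moving the basepoint of `α_{r,t}` along `ω` from `ω(t)` to `ω(t')` gives the image of
`α_{s,t'}` under the inclusion `𝐆_s(a) ⊆ 𝐆_r(a)`. -/
def DefectHomotopy [NeZero k] {ω : ℝ≥0 → Fin D → ℝ} (hω : Continuous ω) :
    Subgroup (∀ i : RayIndex S R a ω, π_ k (Unflawed S a i.r) (rayPt i.stays)) where
  carrier := {x | ∀ (i j : RayIndex S R a ω) (h : i.r ≤ j.r), i.t ≤ j.t →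
    Transports (raySegment i.stays j.t) (x i)
      (piMap k (unflawedIncl S a h) (x := rayPt j.stays) rfl (x j))}
  one_mem' := fun i j h ht => by
    rw [Pi.one_apply, Pi.one_apply, map_one]
    refine Transports.one ?_ ?_ ?_
    · unfold raySegment
      fun_prop
    · exact Subtype.ext (by simp [raySegment, rayPt])
    · refine Subtype.ext ?_
      show ω _ = ω _
      simp [add_tsub_cancel_of_le ht]
  mul_mem' := fun hx hy i j h ht => by
    rw [Pi.mul_apply, Pi.mul_apply, map_mul]
    exact (hx i j h ht).mul (hy i j h ht)
  inv_mem' := fun hx i j h ht => by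
    rw [Pi.inv_apply, Pi.inv_apply, map_inv]
    exact (hx i j h ht).inv

/-! #### Signatures and induced maps -/

variable {S R a k} [NeZero k] {ω : ℝ≥0 → Fin D → ℝ} {hω : Continuous ω}

/-- `f` is the homotopy signature `π_k a : π_k[𝔾_∞(a), ω] → π_k(S)`, where `π_k(S)` is computed
with basepoint `c`: it is induced by the sections `ς^s_a`.  More precisely, for every range `r`
and every large enough `s ≥ r`, the component of `f α` in range `r` is obtained by applying
`ς^s_a` to `α_{s,t} ∈ π_k(𝐆_s(a), ω(t))`, moving the basepoint from `ς^s_a(ω(t))` to `x_s(c)`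
along an arbitrary path in `𝐗_s`, and projecting to `𝐗_r`. -/
def IsHomotopySignature (c : S) (f : DefectHomotopy S R a k hω →* ShiftHomotopy S R k c) :
    Prop :=
  ∀ r : Set.Ici R, ∃ s₀ : Set.Ici R, ∀ (j : RayIndex S R a ω) (_ : s₀ ≤ j.r) (h : r ≤ j.r)
    (γ : Path (sec S a j.r (rayPt j.stays)) (baseVertex c j.r)) (α : DefectHomotopy S R a k hω),
    Transports (fun u => zeta S h (γ u))
      (piMap k ((zeta S h).comp (sec S a j.r)) rfl (α.1 j)) ((f α).1 r)

variable [TopologicalSpace A] {Φ : Config A D → Config A D}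

/-- If `ω` stays in `𝐆_{r+q}(a)`, then it stays in `𝐆_r(Φ(a))`. -/
theorem StaysFrom.image (hΦ : IsCellularAutomaton Φ) (hS : Set.MapsTo Φ S S) {q : ℕ}
    (hq : HasRadius Φ q) {r : ℕ} {t : ℝ≥0} (h : StaysFrom S a ω (r + q) t) :
    StaysFrom S (Φ a) ω r t :=
  fun t' ht' => realization_mono (unflawed_subset hΦ hS hq a r) (h t' ht')

/-- `f = π_k ι : π_k[𝔾_∞(a), ω] → π_k[𝔾_∞(Φ(a)), ω]`: in each range it is induced by the inclusion
`𝐆_{r+q}(a) ⊆ 𝐆_r(Φ(a))`, where `q` is any radius of `Φ`. -/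
def IsHomotopyInclusion (hΦ : IsCellularAutomaton Φ) (hS : Set.MapsTo Φ S S)
    (f : DefectHomotopy S R a k hω →* DefectHomotopy S R (Φ a) k hω) : Prop :=
  ∀ (q : ℕ) (hq : HasRadius Φ q) (r : Set.Ici R) (t : ℝ≥0)
    (h : StaysFrom S a ω (addIdx r q) t) (α : DefectHomotopy S R a k hω),
    (f α).1 ⟨r, t, h.image hΦ hS hq⟩ =
      piMap k (defectIncl hΦ hS hq a r) (x := rayPt h) rfl (α.1 ⟨addIdx r q, t, h⟩)

/-- `f = π_k Φ : π_k(S) → π_k(S)`, where the source is computed with basepoint `c` and the target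
with basepoint `c'`: it is the composite of the homomorphism `π_k(S, c) → π_k(S, Φ(c))` induced
by the maps `Φ_* : 𝐗_{r+q} → 𝐗_r`, and the canonical change of basepoint from `Φ(c)` to `c'`.
More precisely, for every range `r` and every large enough `s ≥ r`, the component of `f β` in range
`r` is obtained by applying `Φ_*` to `β_{s+q}`, moving the basepoint from `x_s(Φ(c))` to `x_s(c')`
along an arbitrary path in `𝐗_s`, and projecting to `𝐗_r`. -/
def IsHomotopyCAMap (hΦ : IsCellularAutomaton Φ) (hS : Set.MapsTo Φ S S) (c c' : S)
    (f : ShiftHomotopy S R k c →* ShiftHomotopy S R k c') : Prop :=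
  ∀ (q : ℕ) (hq : HasRadius Φ q) (r : Set.Ici R), ∃ s₀ : Set.Ici R, ∀ (s : Set.Ici R)
    (_ : s₀ ≤ s) (h : r ≤ s) (γ : Path (baseVertex (⟨Φ c, hS c.2⟩ : S) s) (baseVertex c' s))
    (β : ShiftHomotopy S R k c),
    Transports (fun u => zeta S h (γ u))
      (piMap k ((zeta S h).comp (wangMap hΦ hS hq s))
        (congrArg (zeta S h) (wangMap_baseVertex hΦ hS hq s c)) (β.1 (addIdx s q)))
      ((f β).1 r)

end Homotopy

end DefectSignature

end

/-! Two identities between continuous maps carry the theorem: restricting labels commutes with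
taking sections (`zeta_comp_sec`), and a cellular automaton carries the section of `a` to the
section of `Φ a` (`sec_comp_defectIncl`). Both hold because a block of a configuration, or of its
image, can be read off a larger block. Homology and cohomology are functors, so their part follows
by passing to limits, once compactness supplies a radius (`IsCellularAutomaton.exists_hasRadius`)
and different radii are compared.

For homotopy groups the difficulty is the basepoint. The relation `Transports` is shown to be the
graph of a homomorphism `tr` that depends only on the homotopy class of the path; the homotopies
needed are written down by running a path through a collar of the boundary of the cube
(`Transports.eq_transportLoop`). Basepoint-freeness then gives two facts. The tile complexes are
path connected, so basepoints can be moved. For `s` far beyond `r`, the map from `𝐗_s` to `𝐗_r`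
kills the action of the fundamental group on `π_k` (`ActsTrivially`), so the choice of path is
immaterial in the limit.

Every point of a tile complex lies on the sheet (global section) of some configuration in `S`, and
two sheets meet wherever their blocks agree; weak mixing links any two sheets in this way. A trivial
tower of fundamental groups acts trivially, and for `k = 1` the action is conjugation, so an abelian
tower suffices. Vertex injectivity is a degenerate case: a vertex over `z` remembers the symbol at
`z`, so `S` has at most one element and each sheet is the whole complex.

`existsUnique_hom_shiftHomotopy` turns a directed family of homomorphisms with varying basepoints
into a unique homomorphism to the limit. Applied to sections along the ray it gives the homotopy
signature, applied to the maps `Φ_*` it gives `π_k Φ`. In the final square both composites move one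
and the same class along two paths, which the map to a lower range cannot distinguish. -/

noncomputable section

namespace DefectSignature

/-! ### Change of basepoint in homotopy groups -/

/-! ### Maps on the cube that follow a path in a collar of the boundary -/

section Collar

/-- The radius of a point of the cube: its sup-distance from the centre, scaled so that the boundary
has radius `1`. -/
def cubeRadius {k : ℕ} (u : I^ (Fin k)) : ℝ := ‖fun i => 2 * (u i : ℝ) - 1‖

/-- Dilation of the cube about its centre by the factor `l`, clipped to the cube. -/
def cubeDilate {k : ℕ} (l : ℝ) (u : I^ (Fin k)) : I^ (Fin k) :=
  fun i => Set.projIcc 0 1 zero_le_one (1 / 2 + ((u i : ℝ) - 1 / 2) * l)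

theorem continuous_cubeRadius {k : ℕ} : Continuous (cubeRadius (k := k)) := by
  unfold cubeRadius
  fun_prop

theorem continuous_cubeDilate {k : ℕ} :
    Continuous fun z : ℝ × (I^ (Fin k)) => cubeDilate z.1 z.2 := by
  unfold cubeDilate
  exact continuous_pi fun i => continuous_projIcc.comp (by fun_prop)

theorem cubeRadius_le_one {k : ℕ} (u : I^ (Fin k)) : cubeRadius u ≤ 1 := by
  refine (pi_norm_le_iff_of_nonneg zero_le_one).2 fun i => ?_
  rw [Real.norm_eq_abs, abs_le]
  constructor <;> linarith [(u i).2.1, (u i).2.2]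

theorem cubeRadius_of_mem_boundary {k : ℕ} {u : I^ (Fin k)} (hu : u ∈ Cube.boundary (Fin k)) :
    cubeRadius u = 1 := by
  refine le_antisymm (cubeRadius_le_one u) ?_
  obtain ⟨i, hi⟩ := hu
  refine le_trans ?_ (norm_le_pi_norm (fun i => 2 * (u i : ℝ) - 1) i)
  rcases hi with hi | hi <;> norm_num [hi]

theorem cubeDilate_one {k : ℕ} (u : I^ (Fin k)) : cubeDilate 1 u = u := by
  funext i
  simp [cubeDilate, Set.projIcc_val]

/-- The sup-norm is attained at some coordinate, and the dilation sends that coordinate exactly to 0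
or 1. -/
theorem cubeDilate_mem_boundary {k : ℕ} [NeZero k] {l : ℝ} {u : I^ (Fin k)}
    (hu : cubeRadius u * l = 1) : cubeDilate l u ∈ Cube.boundary (Fin k) := by
  have hn : Nonempty (Fin k) := ⟨⟨0, Nat.pos_of_neZero k⟩⟩
  obtain ⟨i, hi⟩ : ∃ i, cubeRadius u = |2 * (u i : ℝ) - 1| := by
    obtain ⟨i, -, hi⟩ := Finset.exists_mem_eq_sup' Finset.univ_nonempty
      (fun i => ‖2 * (u i : ℝ) - 1‖)
    refine ⟨i, le_antisymm ?_ (norm_le_pi_norm (fun i => 2 * (u i : ℝ) - 1) i)⟩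
    refine (pi_norm_le_iff_of_nonneg (abs_nonneg _)).2 fun j => ?_
    rw [← Real.norm_eq_abs, ← hi]
    exact Finset.le_sup' (fun i => ‖2 * (u i : ℝ) - 1‖) (Finset.mem_univ j)
  refine ⟨i, ?_⟩
  rw [hi] at hu
  rcases abs_cases (2 * (u i : ℝ) - 1) with ⟨h, -⟩ | ⟨h, -⟩
  · right
    exact Set.projIcc_of_right_le _ (by rw [h] at hu; linarith)
  · left
    exact Set.projIcc_of_le_left _ (by rw [h] at hu; linarith)

variable {k : ℕ} {X : Type} [TopologicalSpace X]

/-- The map on the cube given by `f`, shrunk by the factor `l`, in the interior, and by the path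
`g` in a collar of the boundary. -/
def collar (l : ℝ) (f : (I^ (Fin k)) → X) (g : I → X) (u : I^ (Fin k)) : X :=
  if cubeRadius u * l ≤ 1 then f (cubeDilate l u)
  else g (Set.projIcc 0 1 zero_le_one (cubeRadius u * l - 1))

/-- The two pieces are glued where radius times `l` equals 1; there the dilated point lies on the
boundary, where `f` agrees with the start of `g`. The parameter space `Z` lets `l`, `f` and `g`
vary, so that homotopies of collared maps are obtained from the same statement. -/
theorem continuous_collar [NeZero k] {Z : Type} [TopologicalSpace Z] {l : Z → ℝ}
    (hl : Continuous l) {f : Z → (I^ (Fin k)) → X} (hf : Continuous (Function.uncurry f))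
    {g : Z → I → X} (hg : Continuous (Function.uncurry g))
    (hfg : ∀ z, ∀ u ∈ Cube.boundary (Fin k), f z u = g z 0) :
    Continuous fun z : Z × (I^ (Fin k)) => collar (l z.1) (f z.1) (g z.1) z.2 := by
  have hr : Continuous fun z : Z × (I^ (Fin k)) => cubeRadius z.2 * l z.1 :=
    (continuous_cubeRadius.comp continuous_snd).mul (hl.comp continuous_fst)
  have hp : Continuous fun z : Z × (I^ (Fin k)) =>
      Set.projIcc (0 : ℝ) 1 zero_le_one (cubeRadius z.2 * l z.1 - 1) :=
    continuous_projIcc.comp (hr.sub continuous_const)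
  refine Continuous.if_le ?_ ?_ hr continuous_const ?_
  · exact hf.comp (continuous_fst.prodMk
      (continuous_cubeDilate.comp ((hl.comp continuous_fst).prodMk continuous_snd)))
  · exact hg.comp (continuous_fst.prodMk hp)
  · intro z hz
    rw [hfg _ _ (cubeDilate_mem_boundary hz), hz, sub_self]
    exact congrArg _ (Set.projIcc_left zero_le_one).symm

theorem continuous_collar_right [NeZero k] (l : ℝ) {f : (I^ (Fin k)) → X} (hf : Continuous f)
    {g : I → X} (hg : Continuous g) (hfg : ∀ u ∈ Cube.boundary (Fin k), f u = g 0) :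
    Continuous (collar l f g) := by
  have h : Continuous fun z : Unit × (I^ (Fin k)) => collar l f g z.2 :=
    continuous_collar (Z := Unit) (l := fun _ => l) (f := fun _ => f) (g := fun _ => g)
      continuous_const (hf.comp continuous_snd) (hg.comp continuous_snd) fun _ => hfg
  have h' : Continuous fun u : I^ (Fin k) => ((), u) := by fun_prop
  generalize collar l f g = F at h ⊢
  exact h.comp h'

omit [TopologicalSpace X] in
theorem collar_one (f : (I^ (Fin k)) → X) (g : I → X) : collar 1 f g = f := by
  funext u
  rw [collar, if_pos (by simpa using cubeRadius_le_one u), cubeDilate_one]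

omit [TopologicalSpace X] in
theorem collar_of_mem_boundary {f : (I^ (Fin k)) → X} {g : I → X}
    (hfg : ∀ u ∈ Cube.boundary (Fin k), f u = g 0) (s : I) {u : I^ (Fin k)}
    (hu : u ∈ Cube.boundary (Fin k)) : collar (1 + s) f g u = g s := by
  -- At `s = 0` the collar is empty and the value comes from `f`; for `s > 0` a boundary point falls
  -- into the collar.
  by_cases hs : (s : ℝ) ≤ 0
  · obtain rfl : s = 0 := le_antisymm (by exact_mod_cast hs) s.2.1
    rw [Set.Icc.coe_zero, add_zero, collar_one, hfg u hu]
  · rw [collar, cubeRadius_of_mem_boundary hu, if_neg (by linarith)]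
    congr 1
    rw [one_mul, add_sub_cancel_left, Set.projIcc_val]

end Collar

/-! ### Moving the basepoint along a path -/

section Transport

variable {k : ℕ} [NeZero k] {X : Type} [TopologicalSpace X] {x y z : X}

/-- The generalized loop obtained from `p` by moving the basepoint along `γ`. -/
def transportLoop (γ : Path x y) (p : Ω^ (Fin k) X x) : Ω^ (Fin k) X y :=
  ⟨⟨collar 2 p γ, continuous_collar_right 2 p.1.continuous γ.continuous
    fun u hu => (p.2 u hu).trans γ.source.symm⟩, fun u hu => by
    have h := collar_of_mem_boundary (f := p) (g := γ)
      (fun u hu => (p.2 u hu).trans γ.source.symm) 1 hu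
    rw [Set.Icc.coe_one, γ.target, show (1 : ℝ) + 1 = 2 by norm_num] at h
    exact h⟩

theorem transportLoop_apply (γ : Path x y) (p : Ω^ (Fin k) X x) (u : I^ (Fin k)) :
    transportLoop γ p u = collar 2 p γ u := rfl

/-- At time `s` the cube is shrunk by the factor `1 + s` and the collar runs over `γ` up to `γ s`.
-/
theorem exists_transport_homotopy (γ : Path x y) (p : Ω^ (Fin k) X x) :
    ∃ H : C(I × (I^ (Fin k)), X), (∀ u, H (0, u) = p u) ∧ (∀ u, H (1, u) = transportLoop γ p u) ∧
      ∀ s, ∀ u ∈ Cube.boundary (Fin k), H (s, u) = γ s := by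
  have hp : ∀ u ∈ Cube.boundary (Fin k), p u = γ 0 :=
    fun u hu => (p.2 u hu).trans γ.source.symm
  refine ⟨⟨fun v => collar (1 + (v.1 : ℝ)) p γ v.2,
    continuous_collar (Z := I) (l := fun s => 1 + (s : ℝ)) (f := fun _ => p) (g := fun _ => γ)
      (by fun_prop) (p.1.continuous.comp continuous_snd) (γ.continuous.comp continuous_snd)
      fun _ => hp⟩, fun u => ?_, fun u => ?_, fun s u hu => collar_of_mem_boundary hp s hu⟩
  · show collar (1 + ((0 : I) : ℝ)) p γ u = p u
    rw [Set.Icc.coe_zero, add_zero, collar_one]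
  · show collar (1 + ((1 : I) : ℝ)) p γ u = collar 2 p γ u
    rw [Set.Icc.coe_one]
    norm_num

theorem transports_transportLoop (γ : Path x y) (p : Ω^ (Fin k) X x) :
    Transports γ (piMk p) (piMk (transportLoop γ p)) := by
  obtain ⟨H, h⟩ := exists_transport_homotopy γ p
  exact ⟨p, _, H, rfl, rfl, h⟩

omit [NeZero k] in
theorem genLoop_homotopic_of_map {p q : Ω^ (Fin k) X x} (H : I → (I^ (Fin k)) → X)
    (hH : Continuous (Function.uncurry H)) (h0 : ∀ u, H 0 u = p u) (h1 : ∀ u, H 1 u = q u)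
    (hb : ∀ s, ∀ u ∈ Cube.boundary (Fin k), H s u = x) : piMk p = piMk q :=
  Quotient.sound ⟨{
    toFun := Function.uncurry H
    continuous_toFun := hH
    map_zero_left := h0
    map_one_left := h1
    prop' := fun t u hu => (hb t u hu).trans (p.2 u hu).symm }⟩

/-- Growing a collar on which the path is constant keeps the boundary at the basepoint. -/
theorem piMk_transportLoop_refl (q : Ω^ (Fin k) X x) :
    piMk (transportLoop (Path.refl x) q) = piMk q := by
  symm
  refine genLoop_homotopic_of_map (fun s u => collar (1 + (s : ℝ)) q (Path.refl x) u) ?_ ?_ ?_ ?_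
  · exact continuous_collar (Z := I) (l := fun s => 1 + (s : ℝ)) (f := fun _ => q)
      (g := fun _ => Path.refl x) (by fun_prop) (q.1.continuous.comp continuous_snd)
      ((Path.refl x).continuous.comp continuous_snd) fun _ u hu => q.2 u hu
  · intro u
    rw [Set.Icc.coe_zero, add_zero, collar_one]
  · intro u
    rw [transportLoop_apply, Set.Icc.coe_one]
    norm_num
  · exact fun s u hu => collar_of_mem_boundary (f := q) (fun u hu => q.2 u hu) s hu

/-- A homotopy of the loop in the inner cube and one of the path in the collar can be run
simultaneously, since the first keeps the boundary fixed and the second keeps both endpoints fixed.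
-/
theorem piMk_transportLoop_congr {γ γ' : Path x y} (hγ : γ.Homotopic γ') {p p' : Ω^ (Fin k) X x}
    (hp : piMk p = piMk p') : piMk (transportLoop γ p) = piMk (transportLoop γ' p') := by
  obtain ⟨F⟩ : GenLoop.Homotopic p p' := Quotient.exact hp
  obtain ⟨G⟩ := hγ
  have hF : ∀ s, ∀ u ∈ Cube.boundary (Fin k), F (s, u) = x :=
    fun s u hu => (F.eq_fst s hu).trans (p.2 u hu)
  have hc : ∀ s, ∀ u ∈ Cube.boundary (Fin k), F (s, u) = G (s, 0) :=
    fun s u hu => (hF s u hu).trans (G.source s).symm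
  refine genLoop_homotopic_of_map
    (fun s u => collar 2 (fun v => F (s, v)) (fun v => G (s, v)) u) ?_ ?_ ?_ ?_
  · exact continuous_collar (Z := I) (l := fun _ => 2) (f := fun s v => F (s, v))
      (g := fun s v => G (s, v)) continuous_const F.continuous G.continuous hc
  · intro u
    simp only [ContinuousMap.HomotopyWith.apply_zero]
    rfl
  · intro u
    simp only [ContinuousMap.HomotopyWith.apply_one]
    rfl
  · intro s u hu
    have h := collar_of_mem_boundary (f := fun v => F (s, v)) (g := fun v => G (s, v)) (hc s) 1 hu
    rw [Set.Icc.coe_one, show (1 : ℝ) + 1 = 2 by norm_num] at h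
    exact h.trans (G.target s)

/-- The collar construction is the only possible outcome of a free homotopy `H` along `γ`. At time
`s` the inner cube carries `H (s, ·)` and the collar carries the rest of `γ`, from `γ s` to the end,
so the outer boundary never moves. This deforms `transportLoop γ p` into `q` with a constant collar.
-/
theorem Transports.eq_transportLoop {γ : Path x y} {α : π_ k X x} {β : π_ k X y}
    (h : Transports γ α β) : ∃ p : Ω^ (Fin k) X x, α = piMk p ∧ β = piMk (transportLoop γ p) := by
  obtain ⟨p, q, H, hα, hβ, h0, h1, hb⟩ := h
  refine ⟨p, hα, hβ.trans ((piMk_transportLoop_refl q).symm.trans (Eq.symm ?_))⟩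
  have hc : ∀ s, ∀ u ∈ Cube.boundary (Fin k), H (s, u) = γ (s ⊔ 0) := fun s u hu => by
    rw [hb s u hu]
    congr 1
    exact (sup_eq_left.2 (unitInterval.nonneg' (t := s))).symm
  -- The path `v ↦ γ (s ⊔ v)` waits at `γ s` until time `s` and then follows `γ`; it is `γ` for `s =
  -- 0` and constant for `s = 1`.
  refine genLoop_homotopic_of_map
    (fun s u => collar 2 (fun v => H (s, v)) (fun v => γ (s ⊔ v)) u) ?_ ?_ ?_ ?_
  · exact continuous_collar (Z := I) (l := fun _ => 2) (f := fun s v => H (s, v))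
      (g := fun s v => γ (s ⊔ v)) continuous_const H.continuous
      (γ.continuous.comp (continuous_fst.sup continuous_snd)) hc
  · intro u
    have e : (fun v : I => γ (0 ⊔ v)) = γ := funext fun v => congrArg γ (sup_eq_right.2 (unitInterval.nonneg' (t := v)))
    simp only [h0, e]
    rfl
  · intro u
    have e : (fun v : I => γ (1 ⊔ v)) = Path.refl y := funext fun v => by
      rw [sup_eq_left.2 (unitInterval.le_one' (t := v)), γ.target]
      rfl
    simp only [h1, e]
    rfl
  · intro s u hu
    have h := collar_of_mem_boundary (f := fun v => H (s, v)) (g := fun v => γ (s ⊔ v)) (hc s) 1 hu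
    rw [Set.Icc.coe_one, show (1 : ℝ) + 1 = 2 by norm_num] at h
    refine h.trans ?_
    rw [sup_eq_right.2 (unitInterval.le_one' (t := s)), γ.target]

/-- This makes change of basepoint single-valued, although it is given as a relation witnessed by
arbitrary free homotopies and representatives. -/
theorem Transports.eq_of_homotopic {γ γ' : Path x y} (hγ : γ.Homotopic γ') {α : π_ k X x}
    {β β' : π_ k X y} (h : Transports γ α β) (h' : Transports γ' α β') : β = β' := by
  obtain ⟨p, hp, rfl⟩ := h.eq_transportLoop
  obtain ⟨p', hp', rfl⟩ := h'.eq_transportLoop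
  exact piMk_transportLoop_congr hγ (hp.symm.trans hp')

theorem exists_transports (γ : Path x y) (α : π_ k X x) : ∃ β : π_ k X y, Transports γ α β := by
  obtain ⟨p, rfl⟩ : ∃ p, piMk p = α := Quotient.exists_rep α
  exact ⟨_, transports_transportLoop γ p⟩

/-- The change-of-basepoint homomorphism along a path. -/
def tr (k : ℕ) [NeZero k] (γ : Path x y) : π_ k X x →* π_ k X y :=
  MonoidHom.mk' (fun α => (exists_transports γ α).choose) fun α β =>
    Transports.eq_of_homotopic (.refl γ) (exists_transports γ (α * β)).choose_spec
      ((exists_transports γ α).choose_spec.mul (exists_transports γ β).choose_spec)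

theorem transports_tr (γ : Path x y) (α : π_ k X x) : Transports γ α (tr k γ α) :=
  (exists_transports γ α).choose_spec

theorem Transports.tr_eq {γ : Path x y} {α : π_ k X x} {β : π_ k X y} (h : Transports γ α β) :
    tr k γ α = β :=
  (transports_tr γ α).eq_of_homotopic (.refl γ) h

theorem transports_iff {γ : Path x y} {α : π_ k X x} {β : π_ k X y} :
    Transports γ α β ↔ tr k γ α = β :=
  ⟨Transports.tr_eq, fun h => h ▸ transports_tr γ α⟩

theorem tr_congr {γ γ' : Path x y} (h : γ.Homotopic γ') (α : π_ k X x) : tr k γ α = tr k γ' α :=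
  (transports_tr γ α).eq_of_homotopic h (transports_tr γ' α)

theorem tr_refl (α : π_ k X x) : tr k (Path.refl x) α = α := by
  obtain ⟨p, rfl⟩ : ∃ p, piMk p = α := Quotient.exists_rep α
  exact (transports_transportLoop _ p).tr_eq.trans (piMk_transportLoop_refl p)

omit [NeZero k] in
theorem Transports.symm {γ : Path x y} {α : π_ k X x} {β : π_ k X y} (h : Transports γ α β) :
    Transports γ.symm β α := by
  obtain ⟨p, q, H, hα, hβ, h0, h1, hb⟩ := h
  exact ⟨q, p, ⟨fun z => H (unitInterval.symm z.1, z.2), by fun_prop⟩, hβ, hα,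
    fun u => by simpa using h1 u, fun u => by simpa using h0 u,
    fun s u hu => hb (unitInterval.symm s) u hu⟩

theorem tr_symm_tr (γ : Path x y) (α : π_ k X x) : tr k γ.symm (tr k γ α) = α :=
  (transports_tr γ α).symm.tr_eq

theorem tr_tr_symm (γ : Path x y) (α : π_ k X y) : tr k γ (tr k γ.symm α) = α := by
  simpa using tr_symm_tr γ.symm α

theorem tr_trans (γ : Path x y) (δ : Path y z) (α : π_ k X x) :
    tr k (γ.trans δ) α = tr k δ (tr k γ α) := by
  obtain ⟨p, rfl⟩ : ∃ p, piMk p = α := Quotient.exists_rep α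
  obtain ⟨H, h0, h1, hb⟩ := exists_transport_homotopy γ p
  obtain ⟨H', h0', h1', hb'⟩ := exists_transport_homotopy δ (transportLoop γ p)
  rw [(transports_transportLoop γ p).tr_eq, (transports_transportLoop δ _).tr_eq]
  let F : ContinuousMap.Homotopy p.1 (transportLoop γ p).1 := ⟨H, h0, h1⟩
  let F' : ContinuousMap.Homotopy (transportLoop γ p).1
    (transportLoop δ (transportLoop γ p)).1 := ⟨H', h0', h1'⟩
  refine Transports.tr_eq ⟨p, _, (F.trans F').toContinuousMap, rfl, rfl,
    (F.trans F').apply_zero, (F.trans F').apply_one, fun s u hu => ?_⟩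
  -- Concatenation of homotopies and of paths split time at the same point, so on the boundary the
  -- joint homotopy follows `γ.trans δ`.
  refine (ContinuousMap.Homotopy.trans_apply F F' (s, u)).trans ?_
  rw [Path.trans_apply]
  split_ifs
  · exact hb _ u hu
  · exact hb' _ u hu

/-- `Transports` refers only to the underlying function of a path, which a cast of the endpoints
does not change. -/
theorem tr_cast {x' y' : X} (γ : Path x y) (hx : x' = x) (hy : y' = y) (α : π_ k X x')
    (β : π_ k X y') : tr k (γ.cast hx hy) α = β ↔ Transports γ α β :=
  (transports_iff (γ := γ.cast hx hy)).symm

end Transport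

/-! ### Induced maps and change of basepoint -/

section Functoriality

variable {k : ℕ} [NeZero k] {X Y Z : Type} [TopologicalSpace X] [TopologicalSpace Y]
  [TopologicalSpace Z]

theorem Transports.map (f : C(X, Y)) {x y : X} {x' y' : Y} (hx : f x = x') (hy : f y = y')
    {γ : I → X} {α : π_ k X x} {β : π_ k X y} (h : Transports γ α β) :
    Transports (fun u => f (γ u)) (piMap k f hx α) (piMap k f hy β) := by
  obtain ⟨p, q, H, rfl, rfl, h0, h1, hb⟩ := h
  exact ⟨genLoopMap f hx p, genLoopMap f hy q, f.comp H, rfl, rfl, fun u => congrArg f (h0 u),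
    fun u => congrArg f (h1 u), fun s u hu => congrArg f (hb s u hu)⟩

theorem piMap_tr (f : C(X, Y)) {x y : X} (γ : Path x y) (α : π_ k X x) :
    piMap k f rfl (tr k γ α) = tr k (γ.map f.continuous) (piMap k f rfl α) :=
  (Transports.tr_eq (γ := γ.map f.continuous) ((transports_tr γ α).map f rfl rfl)).symm

theorem piMap_piMap (g : C(Y, Z)) (f : C(X, Y)) {x : X} {y : Y} {z : Z} (hf : f x = y)
    (hg : g y = z) (α : π_ k X x) : piMap k g hg (piMap k f hf α) =
      piMap k (g.comp f) ((congrArg g hf).trans hg) α := by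
  obtain ⟨p, rfl⟩ : ∃ p, piMk p = α := Quotient.exists_rep α
  rfl

theorem piMap_congr {f g : C(X, Y)} (h : f = g) {x : X} {y : Y} (hf : f x = y) (hg : g x = y)
    (α : π_ k X x) : piMap k f hf α = piMap k g hg α := by
  subst h
  rfl

end Functoriality

/-! ### Maps that trivialize the action of the fundamental group -/

section ActsTrivially

variable {k : ℕ} [NeZero k] {X Y Z : Type} [TopologicalSpace X] [TopologicalSpace Y]
  [TopologicalSpace Z]

/-- The image in `π_k(Y)` of `π_k(X)` is fixed by the image of the fundamental group of `X`. -/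
def ActsTrivially (k : ℕ) [NeZero k] (f : C(X, Y)) : Prop :=
  ∀ (x : X) (ℓ : Path x x) (α : π_ k X x), piMap k f rfl (tr k ℓ α) = piMap k f rfl α

theorem ActsTrivially.comp_right {f : C(Y, Z)} (hf : ActsTrivially k f) (g : C(X, Y)) :
    ActsTrivially k (f.comp g) := by
  intro x ℓ α
  have h := hf (g x) (ℓ.map g.continuous) (piMap k g rfl α)
  rwa [← piMap_tr, piMap_piMap, piMap_piMap] at h

/-- Two paths with the same endpoints differ by the loop `γ.symm.trans γ'`, whose action `f` does
not see. -/
theorem ActsTrivially.piMap_eq {f : C(X, Y)} (hf : ActsTrivially k f) {x x' : X} {y : Y}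
    (hy : f x' = y) (γ γ' : Path x x') (α : π_ k X x) :
    piMap k f hy (tr k γ α) = piMap k f hy (tr k γ' α) := by
  subst hy
  have h := hf x' (γ.symm.trans γ') (tr k γ α)
  rw [tr_trans, tr_symm_tr] at h
  exact h.symm

/-- A loop at `x` is conjugated to a loop at `x₀` by a connecting path, and the class is moved along
with it. -/
theorem actsTrivially_of_basepoint [PathConnectedSpace X] {f : C(X, Y)} (x₀ : X)
    (h : ∀ (ℓ : Path x₀ x₀) (α : π_ k X x₀), piMap k f rfl (tr k ℓ α) = piMap k f rfl α) :
    ActsTrivially k f := by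
  intro x ℓ α
  let δ : Path x₀ x := PathConnectedSpace.somePath x₀ x
  have h1 := h ((δ.trans ℓ).trans δ.symm) (tr k δ.symm α)
  rw [tr_trans, tr_trans, tr_tr_symm] at h1
  have h2 := congrArg (tr k (δ.map f.continuous)) h1
  rwa [← piMap_tr, ← piMap_tr, tr_tr_symm, tr_tr_symm] at h2

theorem actsTrivially_of_null {f : C(X, Y)} {x : X} {ℓ : Path x x}
    (h : (ℓ.map f.continuous).Homotopic (Path.refl (f x))) (α : π_ k X x) :
    piMap k f rfl (tr k ℓ α) = piMap k f rfl α := by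
  rw [piMap_tr, tr_congr h, tr_refl]

/-- A loop as a one-dimensional generalized loop. -/
def pathLoop {x : X} (ℓ : Path x x) : Ω^ (Fin 1) X x := (genLoopEquivOfUnique (Fin 1)).symm ℓ

theorem pathLoop_surjective {x : X} (p : Ω^ (Fin 1) X x) : ∃ ℓ : Path x x, pathLoop ℓ = p :=
  (genLoopEquivOfUnique (Fin 1)).symm.surjective p

theorem piMk_pathLoop_eq_iff {x : X} {ℓ ℓ' : Path x x} :
    piMk (pathLoop ℓ) = piMk (pathLoop ℓ') ↔ ℓ.Homotopic ℓ' := by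
  have h := (HomotopyGroup.pi1EquivFundamentalGroup (X := X) (x := x)).apply_eq_iff_eq
    (x := piMk (pathLoop ℓ)) (y := piMk (pathLoop ℓ'))
  refine h.symm.trans ?_
  have e : ∀ ℓ : Path x x, HomotopyGroup.pi1EquivFundamentalGroup (piMk (pathLoop ℓ)) =
    Path.Homotopic.Quotient.mk ℓ := fun _ => rfl
  rw [e, e]
  exact Path.Homotopic.Quotient.eq

/-- The product in `π_1` concatenates in the opposite order; this fixes the sides in the conjugation
formula used for the abelian case. -/
theorem piMk_pathLoop_mul {x : X} (ℓ ℓ' : Path x x) :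
    piMk (pathLoop ℓ) * piMk (pathLoop ℓ') = piMk (pathLoop (ℓ'.trans ℓ)) := by
  rw [piMk_mul default]
  congr 1

theorem piMap_pathLoop (f : C(X, Y)) {x : X} (ℓ : Path x x) :
    piMap 1 f rfl (piMk (pathLoop ℓ)) = piMk (pathLoop (ℓ.map f.continuous)) := rfl

theorem actsTrivially_of_trivial [PathConnectedSpace X] {f : C(X, Y)} (x₀ : X)
    (h : ∀ g : π_ 1 X x₀, piMap 1 f rfl g = 1) : ActsTrivially k f := by
  refine actsTrivially_of_basepoint x₀ fun ℓ α => actsTrivially_of_null ?_ α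
  have h1 := h (piMk (pathLoop ℓ))
  rw [piMap_pathLoop, piMk_one] at h1
  exact piMk_pathLoop_eq_iff.1 h1

/-- The two ways round a square are homotopic. This is naturality of the homotopy `F`, applied to
the identity path of the interval. -/
theorem homotopic_of_square {x y : X} {p : Path x x} {q : Path y y} {γ : Path x y}
    (H : C(I × I, X)) (h0 : ∀ t, H (0, t) = p t) (h1 : ∀ t, H (1, t) = q t)
    (hl : ∀ s, H (s, 0) = γ s) (hr : ∀ s, H (s, 1) = γ s) :
    (p.trans γ).Homotopic (γ.trans q) := by
  let F : ContinuousMap.Homotopy p.toContinuousMap q.toContinuousMap := ⟨H, h0, h1⟩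
  have h := (Path.Homotopic.map_trans_evalAt F Path.id).pathCast p.source.symm q.target.symm
  have e1 : ((Path.id.map p.continuous).trans (F.evalAt 1)).cast p.source.symm q.target.symm =
      p.trans γ := by
    ext t
    rw [Path.cast_coe, Path.trans_apply, Path.trans_apply]
    split_ifs
    · rfl
    · exact hr _
  have e2 : ((F.evalAt 0).trans (Path.id.map q.continuous)).cast p.source.symm q.target.symm =
      γ.trans q := by
    ext t
    rw [Path.cast_coe, Path.trans_apply, Path.trans_apply]
    split_ifs
    · exact hl _
    · rfl
  rw [← e1, ← e2]
  exact h

/-- For `k = 1` change of basepoint is conjugation: the free homotopy is a square whose two vertical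
sides are both `γ`. -/
theorem tr_pathLoop {x y : X} (γ : Path x y) (p : Path x x) {q : Path y y}
    (h : tr 1 γ (piMk (pathLoop p)) = piMk (pathLoop q)) :
    (p.trans γ).Homotopic (γ.trans q) := by
  obtain ⟨p', q', H, hp, hq, h0, h1, hb⟩ := transports_iff.2 h
  obtain ⟨p', rfl⟩ := pathLoop_surjective p'
  obtain ⟨q', rfl⟩ := pathLoop_surjective q'
  have hp := piMk_pathLoop_eq_iff.1 hp
  have hq := piMk_pathLoop_eq_iff.1 hq
  have hs : (p'.trans γ).Homotopic (γ.trans q') :=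
    homotopic_of_square (H.comp ⟨fun z => (z.1, fun _ => z.2), by fun_prop⟩)
      (fun t => h0 _) (fun t => h1 _) (fun s => hb s _ ⟨0, Or.inl rfl⟩)
      (fun s => hb s _ ⟨0, Or.inr rfl⟩)
  exact (hp.hcomp (.refl γ)).trans (hs.trans ((Path.Homotopic.refl γ).hcomp hq.symm))

theorem actsTrivially_of_abelian [PathConnectedSpace X] {f : C(X, Y)} (x₀ : X)
    (h : ∀ g g' : π_ 1 X x₀, piMap 1 f rfl (g * g') = piMap 1 f rfl (g' * g)) :
    ActsTrivially 1 f := by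
  refine actsTrivially_of_basepoint x₀ fun ℓ α => ?_
  obtain ⟨p, rfl⟩ : ∃ p, piMk p = α := Quotient.exists_rep α
  obtain ⟨p, rfl⟩ := pathLoop_surjective p
  obtain ⟨q, hq⟩ : ∃ q, piMk q = tr 1 ℓ (piMk (pathLoop p)) := Quotient.exists_rep _
  obtain ⟨q, rfl⟩ := pathLoop_surjective q
  have h1 := piMk_pathLoop_eq_iff.2 (tr_pathLoop ℓ p hq.symm)
  -- Now `h1` reads `[ℓ][p] = [q][ℓ]`. Commuting the left side after applying `f` and cancelling the
  -- image of `[ℓ]` gives equal images of `[p]` and `[q]`.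
  rw [← piMk_pathLoop_mul, ← piMk_pathLoop_mul] at h1
  have h2 := congrArg (piMap 1 f rfl) h1
  rw [h, map_mul, map_mul] at h2
  rw [← hq]
  exact (mul_right_cancel h2).symm

end ActsTrivially

/-! ### Topology of the tile complexes of a subshift -/

section Wang

variable {A : Type} {D : ℕ} {S : Set (Config A D)} {R : ℕ}

theorem block_shift (v z : Lat D) (c : Config A D) (r : ℕ) :
    block (shift v c) z r = block c (z + v) r := by
  funext u
  simp only [block, shift]
  congr 1
  abel

theorem IsSFT.shift_mem (hS : IsSFT S R) (v : Lat D) {c : Config A D} (hc : c ∈ S) :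
    shift v c ∈ S := by
  rw [hS] at hc ⊢
  intro z
  rw [block_shift]
  exact hc _

theorem IsSFT.block_mem (hS : IsSFT S R) {c : Config A D} (hc : c ∈ S) (z : Lat D) (r : ℕ) :
    block c z r ∈ Adm S r :=
  ⟨shift z c, hS.shift_mem z hc, by
    show block (shift z c) 0 r = _
    rw [block_shift, zero_add]⟩

theorem mem_unitCube_floor (x : Fin D → ℝ) : x ∈ unitCube fun i => ⌊x i⌋ :=
  fun _ => ⟨Int.floor_le _, (Int.lt_floor_add_one _).le⟩

theorem lattice_mem_unitCube (z : Lat D) : (fun i => (z i : ℝ)) ∈ unitCube z :=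
  fun _ => ⟨le_rfl, by simp⟩

theorem IsSFT.mem_realization (hS : IsSFT S R) {c : Config A D} (hc : c ∈ S) (r : ℕ)
    (x : Fin D → ℝ) : x ∈ realization (unflawed S c r) :=
  Set.mem_biUnion (x := fun i => ⌊x i⌋) (fun _ _ => hS.block_mem hc _ r) (mem_unitCube_floor x)

/-- The section `ℝ^D → 𝐗_r` determined by an admissible configuration. -/
def globalSec (hS : IsSFT S R) (c : S) (r : ℕ) : C(Fin D → ℝ, WangComplex S r) :=
  (sec S c.1 r).comp ⟨fun x => ⟨x, hS.mem_realization c.2 r x⟩, by fun_prop⟩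

theorem globalSec_apply (hS : IsSFT S R) (c : S) (r : ℕ) {x : Fin D → ℝ} {z : Lat D}
    (hx : x ∈ unitCube z) : globalSec hS c r x =
      TileComplex.mk _ z ⟨block c.1 z r, hS.block_mem c.2 z r⟩ ⟨x, hx⟩ :=
  sectionFun_eq S c.1 r _ z (fun _ _ => hS.block_mem c.2 _ r) _ hx

theorem globalSec_congr (hS : IsSFT S R) {c c' : S} {r : ℕ} {x : Fin D → ℝ} {z : Lat D}
    (hx : x ∈ unitCube z) (h : block c.1 z r = block c'.1 z r) :
    globalSec hS c r x = globalSec hS c' r x := by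
  rw [globalSec_apply hS c r hx, globalSec_apply hS c' r hx]
  simp only [h]

/-- An admissible block is the central block of some `c ∈ S`; shifting `c` by `-z` puts that block
at the site `z`. Hence the tile complex is covered by the sheets of elements of `S`. -/
theorem mk_eq_globalSec (hS : IsSFT S R) {r : ℕ} (z : Lat D) (w : WangTile S r) (x : unitCube z) :
    ∃ c : S, TileComplex.mk _ z w x = globalSec hS c r x := by
  obtain ⟨_, c, hc, rfl⟩ := w
  refine ⟨⟨shift (-z) c, hS.shift_mem _ hc⟩, ?_⟩
  rw [globalSec_apply hS _ r x.2]
  congr 2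
  rw [block_shift, add_neg_cancel]

theorem exists_globalSec (hS : IsSFT S R) {r : ℕ} (p : WangComplex S r) :
    ∃ (c : S) (x : Fin D → ℝ), p = globalSec hS c r x := by
  obtain ⟨⟨⟨z, w⟩, x⟩, rfl⟩ := Quot.exists_rep p
  obtain ⟨c, hc⟩ := mk_eq_globalSec hS z w x
  exact ⟨c, x, hc⟩

theorem joined_globalSec (hS : IsSFT S R) (c : S) (r : ℕ) (x y : Fin D → ℝ) :
    Joined (globalSec hS c r x) (globalSec hS c r y) :=
  ⟨(PathConnectedSpace.somePath x y).map (globalSec hS c r).continuous⟩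

theorem finite_box (D r : ℕ) : Finite (Box D r) := by
  refine Set.Finite.to_subtype ((Set.Finite.pi' fun _ : Fin D =>
    Set.finite_Icc (-(r : ℤ)) r).subset ?_)
  exact fun _ hu i => abs_le.1 (hu i)

theorem isOpen_block_eq [TopologicalSpace A] [DiscreteTopology A] (z : Lat D) (r : ℕ)
    (w : Block A D r) : IsOpen {c : Config A D | block c z r = w} := by
  have := finite_box D r
  have h : Continuous fun c : Config A D => block c z r :=
    continuous_pi fun u => continuous_apply _
  exact (isOpen_discrete {w}).preimage h

/-- Each sheet is a path connected copy of `ℝ^D`, so it suffices to link the sheets of `c` and `c'`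
by sheets that share cubes. A shared cube needs equal blocks at the same site, so transitivity of
`S` alone does not provide the link; weak mixing gives two configurations that agree with `c` at one
site and with `c` and `c'` respectively at another. -/
theorem WeaklyMixing.pathConnectedSpace [TopologicalSpace A] [DiscreteTopology A]
    (hM : WeaklyMixing S) (hS : IsSFT S R) (c₀ : S) (r : ℕ) :
    PathConnectedSpace (WangComplex S r) := by
  refine ⟨⟨baseVertex c₀ r⟩, fun p q => ?_⟩
  obtain ⟨c, x, rfl⟩ := exists_globalSec hS p
  obtain ⟨c', x', rfl⟩ := exists_globalSec hS q
  have ho := isOpen_block_eq (A := A) (D := D) 0 r (block c.1 0 r)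
  have ho' := isOpen_block_eq (A := A) (D := D) 0 r (block c'.1 0 r)
  -- Both `d` and `d'` show the central block of `c`, while after the shift by `z` they show those
  -- of `c` and `c'`. So the sheet of `e` meets that of `c` over `0`, that of `e'` over `-z`, and
  -- the sheet of `e'` meets that of `c'` over `0`.
  obtain ⟨z, ⟨d, d'⟩, ⟨⟨h1, h1'⟩, h2, h2'⟩, h3, h3'⟩ := hM _ _ (ho.prod ho) (ho.prod ho')
    ⟨(c.1, c.1), ⟨rfl, rfl⟩, c.2, c.2⟩ ⟨(c.1, c'.1), ⟨rfl, rfl⟩, c.2, c'.2⟩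
  let e : S := ⟨shift z d, hS.shift_mem z h2⟩
  let e' : S := ⟨shift z d', hS.shift_mem z h2'⟩
  have h0 : (fun i => (((0 : Lat D) i : ℤ) : ℝ)) ∈ unitCube (0 : Lat D) := lattice_mem_unitCube 0
  have e1 : globalSec hS c r _ = globalSec hS e r _ := globalSec_congr hS h0 h3.symm
  have e2 : globalSec hS c' r _ = globalSec hS e' r _ := globalSec_congr hS h0 h3'.symm
  have e3 : globalSec hS e r _ = globalSec hS e' r _ :=
    globalSec_congr hS (lattice_mem_unitCube (-z)) (by
      simp only [e, e', block_shift, neg_add_cancel]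
      exact h1.trans h1'.symm)
  have j1 := joined_globalSec hS c r x (fun i => (((0 : Lat D) i : ℤ) : ℝ))
  rw [e1] at j1
  have j2 := joined_globalSec hS c' r (fun i => (((0 : Lat D) i : ℤ) : ℝ)) x'
  rw [e2] at j2
  have j3 := joined_globalSec hS e r (fun i => (((0 : Lat D) i : ℤ) : ℝ))
    (fun i => (((-z) i : ℤ) : ℝ))
  rw [e3] at j3
  exact j1.trans (j3.trans ((joined_globalSec hS e' r _ _).trans j2))

theorem weaklyMixing_of_subsingleton [TopologicalSpace A] (hS : S.Subsingleton) :
    WeaklyMixing S := by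
  rintro U V - - ⟨⟨c, c'⟩, hU, hc, hc'⟩ ⟨⟨d, d'⟩, hV, hd, hd'⟩
  obtain rfl := hS hc hd
  obtain rfl := hS hc' hd'
  refine ⟨0, (c, c'), ⟨hU, hc, hc'⟩, ?_⟩
  have h : ∀ b : Config A D, shift 0 b = b := fun b => funext fun z => by simp [shift]
  simpa only [h] using hV

/-! #### Injectivity on vertices -/

/-- The symbol of a point of `𝐗_r` at the site obtained by rounding down its coordinates. -/
def floorSymbol (S : Set (Config A D)) {r : ℕ} (hr : 1 ≤ r) : WangComplex S r → A :=
  Quot.lift (fun p => if h : ∀ i, |(fun i => ⌊p.2.1 i⌋ - p.1.1 i : Lat D) i| ≤ (r : ℤ)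
      then p.1.2.1 ⟨_, h⟩ else p.1.2.1 ⟨0, fun i => by simp⟩) (by
    -- The coordinates of `⌊x⌋ - z` are 0 or 1, which is where `1 ≤ r` enters; the default branch is
    -- never taken.
    have key : ∀ p : PreComplex D (WangTile S r),
        ∀ i, |(fun i => ⌊p.2.1 i⌋ - p.1.1 i : Lat D) i| ≤ (r : ℤ) := by
      rintro ⟨⟨z, w⟩, x, hx⟩ i
      have h1 : z i ≤ ⌊x i⌋ := Int.le_floor.2 (hx i).1
      have h2 : ⌊x i⌋ ≤ z i + 1 := by
        have h3 := (Int.floor_le (x i)).trans (hx i).2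
        exact_mod_cast h3
      have hr' : (1 : ℤ) ≤ r := by exact_mod_cast hr
      show |⌊x i⌋ - z i| ≤ (r : ℤ)
      rw [abs_le]
      constructor <;> omega
    rintro p q ⟨d, h1, h2, h3⟩
    rw [dif_pos (key p), dif_pos (key q)]
    refine h2 _ _ ?_
    funext i
    simp only [h1, h3, Pi.add_apply]
    ring)

theorem floorSymbol_globalSec (hS : IsSFT S R) {r : ℕ} (hr : 1 ≤ r) (c : S) (z : Lat D) :
    floorSymbol S hr (globalSec hS c r fun i => (z i : ℝ)) = c.1 z := by
  rw [globalSec_apply hS c r (lattice_mem_unitCube z)]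
  show dite _ _ _ = _
  rw [dif_pos (fun i => by simp)]
  simp only [block, Int.floor_intCast, sub_self]
  exact congrArg c.1 (add_zero z)

theorem proj_globalSec (hS : IsSFT S R) (c : S) (r : ℕ) (x : Fin D → ℝ) :
    TileComplex.proj _ (globalSec hS c r x) = x := by
  rw [globalSec_apply hS c r (mem_unitCube_floor x)]
  rfl

/-- The sheets of any two elements of `S` pass through the same vertex over `z`, and `floorSymbol`
reads the symbol at `z` of either one from it. -/
theorem VertexInjective.subsingleton (hS : IsSFT S R) {r : ℕ} (hr : 1 ≤ r)
    (h : VertexInjective S r) : S.Subsingleton := by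
  intro c hc c' hc'
  funext z
  have e := floorSymbol_globalSec hS hr ⟨c, hc⟩ z
  rw [h _ _ z (proj_globalSec hS _ r _) (proj_globalSec hS ⟨c', hc'⟩ r _)] at e
  exact e.symm.trans (floorSymbol_globalSec hS hr ⟨c', hc'⟩ z)

theorem globalSec_proj_of_subsingleton (hS : IsSFT S R) (h : S.Subsingleton) (c : S) (r : ℕ)
    (p : WangComplex S r) : globalSec hS c r (TileComplex.proj _ p) = p := by
  obtain ⟨c', x, rfl⟩ := exists_globalSec hS p
  obtain rfl : c = c' := Subtype.ext (h c.2 c'.2)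
  rw [proj_globalSec]

/-- The projection and the single sheet are inverse to each other, so a loop is null-homotopic
because its projection to `ℝ^D` is. -/
theorem null_of_subsingleton (hS : IsSFT S R) (h : S.Subsingleton) (c : S) (r : ℕ)
    {p : WangComplex S r} (ℓ : Path p p) : ℓ.Homotopic (Path.refl p) := by
  have h1 := (SimplyConnectedSpace.paths_homotopic
    (ℓ.map (TileComplex.proj _).continuous) (Path.refl _)).map (globalSec hS c r)
  have h2 := h1.pathCast (globalSec_proj_of_subsingleton hS h c r p).symm
    (globalSec_proj_of_subsingleton hS h c r p).symm
  convert h2 using 1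
  · ext t
    exact (globalSec_proj_of_subsingleton hS h c r _).symm
  · ext t
    exact (globalSec_proj_of_subsingleton hS h c r _).symm

/-! #### Basepoint-freeness -/

theorem zeta_comp {r s t : ℕ} (h : r ≤ s) (h' : s ≤ t) :
    (zeta S h).comp (zeta S h') = zeta S (h.trans h') := by
  ext p
  obtain ⟨p, rfl⟩ := Quot.exists_rep p
  rfl

theorem BasepointFree.pathConnectedSpace [TopologicalSpace A] [DiscreteTopology A] {k : ℕ}
    (hB : BasepointFree S R k) (hS : IsSFT S R) (c : S) (r : ℕ) :
    PathConnectedSpace (WangComplex S r) := by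
  have hM : WeaklyMixing S := by
    rcases hB with ⟨r₀, h⟩ | h | h
    -- The maximum with 1 is the range from which a vertex determines its symbol.
    · exact weaklyMixing_of_subsingleton
        ((h _ (le_max_left r₀ 1)).subsingleton hS (le_max_right r₀ 1))
    · exact h.1
    · exact h.1
  exact hM.pathConnectedSpace hS c r

theorem BasepointFree.exists_actsTrivially [TopologicalSpace A] [DiscreteTopology A] {k : ℕ}
    [NeZero k] (hB : BasepointFree S R k) (hS : IsSFT S R) (c : S) (r : Set.Ici R) :
    ∃ (s : Set.Ici R) (h : r ≤ s), ActsTrivially k (zeta S h) := by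
  have hP := fun r => hB.pathConnectedSpace hS c r
  rcases hB with ⟨r₀, h⟩ | ⟨-, rfl, c₁, h⟩ | ⟨-, c₁, h⟩
  · have h1 := (h _ (le_max_left r₀ 1)).subsingleton hS (le_max_right r₀ 1)
    exact ⟨r, le_rfl, fun x ℓ α =>
      actsTrivially_of_null ((null_of_subsingleton hS h1 c r ℓ).map _) α⟩
  · obtain ⟨s, hs, h⟩ := h r
    have := hP s
    exact ⟨s, hs, actsTrivially_of_abelian (baseVertex c₁ s) h⟩
  · obtain ⟨s, hs, h⟩ := h r
    have := hP s
    exact ⟨s, hs, actsTrivially_of_trivial (baseVertex c₁ s) h⟩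

/-- Once one map into range `r` kills the action, so does every map from a higher range, since it
factors through that one. -/
theorem BasepointFree.eventually_actsTrivially [TopologicalSpace A] [DiscreteTopology A] {k : ℕ}
    [NeZero k] (hB : BasepointFree S R k) (hS : IsSFT S R) (c : S) (r : Set.Ici R) :
    ∃ s₀ : Set.Ici R, r ≤ s₀ ∧ ∀ (s : Set.Ici R) (_ : s₀ ≤ s) (h : r ≤ s),
      ActsTrivially k (zeta S h) := by
  obtain ⟨s₀, h₀, hs₀⟩ := hB.exists_actsTrivially hS c r
  refine ⟨s₀, h₀, fun s hs h => ?_⟩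
  rw [← zeta_comp (S := S) h₀ hs]
  exact hs₀.comp_right _

end Wang

/-! ### Naturality of sections and of the maps induced by a cellular automaton -/

section Naturality

variable {A : Type} {D : ℕ} {S : Set (Config A D)} {R : ℕ}

theorem inclusion_comp_inclusion {X : Type} [TopologicalSpace X] {s t u : Set X} (h : s ⊆ t)
    (h' : t ⊆ u) : (⟨Set.inclusion h', continuous_inclusion h'⟩ : C(t, u)).comp
      ⟨Set.inclusion h, continuous_inclusion h⟩ =
        ⟨Set.inclusion (h.trans h'), continuous_inclusion _⟩ := rfl

theorem sec_apply (a : Config A D) (r : ℕ) (x : Unflawed S a r) :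
    ∃ (z : Lat D) (hz : z ∈ unflawed S a r) (hx : x.1 ∈ unitCube z),
      corners z ⊆ unflawed S a r ∧
        sec S a r x = TileComplex.mk _ z ⟨block a z r, hz⟩ ⟨x.1, hx⟩ := by
  obtain ⟨z, hc, hx⟩ := exists_cube x
  exact ⟨z, hc fun _ => Or.inl rfl, hx, hc, sectionFun_eq S a r x z hc _ hx⟩

theorem zeta_comp_sec (a : Config A D) {r s : ℕ} (h : r ≤ s) :
    (zeta S h).comp (sec S a s) = (sec S a r).comp (unflawedIncl S a h) := by
  ext x
  obtain ⟨z, hz, hx, hc, e⟩ := sec_apply a s x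
  refine (congrArg (zeta S h) e).trans (Eq.symm ?_)
  exact sectionFun_eq S a r _ z (hc.trans (unflawed_anti S a h)) _ hx

/-! ### Naturality under a cellular automaton -/

variable [TopologicalSpace A] {Φ : Config A D → Config A D} (hΦ : IsCellularAutomaton Φ)
  (hS : Set.MapsTo Φ S S)
include hΦ

/-- `tileMap` evaluates `Φ` on a chosen element of `S` with the given block. The choice is
irrelevant by locality, so it may be replaced by `a` itself, even when `a` is not in `S`. -/
theorem tileMap_of_block {q : ℕ} (hq : HasRadius Φ q) (r : ℕ) {a : Config A D} {z : Lat D}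
    (hz : block a z (r + q) ∈ Adm S (r + q)) :
    (tileMap hS q r ⟨block a z (r + q), hz⟩).1 = block (Φ a) z r :=
  hΦ.block_eq hq r hz.choose_spec.2

theorem zeta_comp_wangMap {q : ℕ} (hq : HasRadius Φ q) {r s : ℕ} (h : r ≤ s) :
    (zeta S h).comp (wangMap hΦ hS hq s) =
      (wangMap hΦ hS hq r).comp (zeta S (Nat.add_le_add_right h q)) := by
  ext p
  obtain ⟨⟨⟨z, _, c, hc, rfl⟩, x⟩, rfl⟩ := Quot.exists_rep p
  refine congrArg (fun w => TileComplex.mk (wangMatch S r) z w x) (Subtype.ext ?_)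
  refine (congrArg (restrictBlock h) (tileMap_of_block hΦ hS hq s ⟨c, hc, rfl⟩)).trans ?_
  exact (tileMap_of_block hΦ hS hq r ⟨c, hc, rfl⟩).symm

theorem wangMap_eq_comp_zeta {q q' : ℕ} (hq : HasRadius Φ q) (hq' : HasRadius Φ q') (h : q ≤ q')
    (r : ℕ) : wangMap hΦ hS hq' r =
      (wangMap hΦ hS hq r).comp (zeta S (Nat.add_le_add_left h r)) := by
  ext p
  obtain ⟨⟨⟨z, _, c, hc, rfl⟩, x⟩, rfl⟩ := Quot.exists_rep p
  refine congrArg (fun w => TileComplex.mk (wangMatch S r) z w x) (Subtype.ext ?_)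
  exact (tileMap_of_block hΦ hS hq' r ⟨c, hc, rfl⟩).trans
    (tileMap_of_block hΦ hS hq r ⟨c, hc, rfl⟩).symm

/-- The identity behind every commuting square: the cube over `z` is labelled by the block of `Φ a`
at `z`, computed either from `a` directly or from its label. -/
theorem sec_comp_defectIncl {q : ℕ} (hq : HasRadius Φ q) (a : Config A D) (r : ℕ) :
    (sec S (Φ a) r).comp (defectIncl hΦ hS hq a r) =
      (wangMap hΦ hS hq r).comp (sec S a (r + q)) := by
  ext x
  obtain ⟨z, hz, hx, hc, e⟩ := sec_apply a (r + q) x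
  refine Eq.trans ?_ (congrArg (wangMap hΦ hS hq r) e).symm
  refine (sectionFun_eq S (Φ a) r _ z (hc.trans (unflawed_subset hΦ hS hq a r))
    (unflawed_subset hΦ hS hq a r hz) hx).trans ?_
  exact congrArg (fun w => TileComplex.mk (wangMatch S r) z w ⟨x.1, hx⟩)
    (Subtype.ext (tileMap_of_block hΦ hS hq r hz).symm)

theorem unflawedIncl_comp_defectIncl {q : ℕ} (hq : HasRadius Φ q) (a : Config A D) {r s : ℕ}
    (h : r ≤ s) : (unflawedIncl S (Φ a) h).comp (defectIncl hΦ hS hq a s) =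
      (defectIncl hΦ hS hq a r).comp (unflawedIncl S a (Nat.add_le_add_right h q)) :=
  (inclusion_comp_inclusion _ _).trans (inclusion_comp_inclusion _ _).symm

theorem defectIncl_eq_comp_unflawedIncl {q q' : ℕ} (hq : HasRadius Φ q) (hq' : HasRadius Φ q')
    (h : q ≤ q') (a : Config A D) (r : ℕ) : defectIncl hΦ hS hq' a r =
      (defectIncl hΦ hS hq a r).comp (unflawedIncl S a (Nat.add_le_add_left h r)) :=
  (inclusion_comp_inclusion _ _).symm

omit hΦ [TopologicalSpace A] in
theorem block_eq_of_le {a b : Config A D} {z y : Lat D} {r s : ℕ} (h : r ≤ s)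
    (e : block a z s = block b y s) : block a z r = block b y r :=
  congrArg (restrictBlock h) e

/-- The Curtis–Hedlund–Lyndon argument: continuity gives a radius near each configuration,
compactness makes it uniform at the site `0`, and commutation with shifts carries it to all sites.
-/
theorem IsCellularAutomaton.exists_hasRadius [Finite A] [DiscreteTopology A] :
    ∃ q, HasRadius Φ q := by
  have hloc : ∀ a : Config A D, ∃ n : ℕ, ∀ b, block b 0 n = block a 0 n → Φ b 0 = Φ a 0 := by
    intro a
    have ho : IsOpen {b | Φ b 0 = Φ a 0} :=
      (isOpen_discrete {Φ a 0}).preimage ((continuous_apply 0).comp hΦ.continuous)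
    obtain ⟨F, u, hu, hsub⟩ := isOpen_pi_iff.1 ho a rfl
    -- The radius of the smallest centred box containing the finite set of coordinates on which the
    -- basic neighbourhood depends.
    refine ⟨F.sup fun z => Finset.univ.sup fun i => (z i).natAbs, fun b hb => hsub ?_⟩
    intro z hz
    have hb' := congrFun hb ⟨z, fun i => ?_⟩
    · simp only [block, zero_add] at hb'
      rw [hb']
      exact (hu z hz).2
    · have h1 : (z i).natAbs ≤ Finset.univ.sup fun i => (z i).natAbs :=
        Finset.le_sup (f := fun i => (z i).natAbs) (Finset.mem_univ i)
      have h2 := Finset.le_sup (f := fun z : Lat D => Finset.univ.sup fun i => (z i).natAbs) hz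
      rw [Int.abs_eq_natAbs]
      exact_mod_cast h1.trans h2
  choose n hn using hloc
  obtain ⟨T, hT⟩ := isCompact_univ.elim_finite_subcover
    (fun a : Config A D => {b : Config A D | block b 0 (n a) = block a 0 (n a)})
    (fun a => isOpen_block_eq 0 (n a) _) fun a _ => Set.mem_iUnion.2 ⟨a, rfl⟩
  have key : ∀ a b : Config A D, block a 0 (T.sup n) = block b 0 (T.sup n) → Φ a 0 = Φ b 0 := by
    intro a b hab
    obtain ⟨c, hc, hac⟩ := Set.mem_iUnion₂.1 (hT (Set.mem_univ a))
    have h1 := block_eq_of_le (Finset.le_sup hc) hab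
    exact (hn c a hac).trans (hn c b (h1.symm.trans hac)).symm
  refine ⟨T.sup n, fun a b z hab => ?_⟩
  have h1 := key (shift z a) (shift z b) (by rwa [block_shift, block_shift, zero_add])
  rw [hΦ.comm, hΦ.comm] at h1
  simpa [shift] using h1

end Naturality

/-! ### Homomorphisms into the homotopy groups of a subshift -/

section ShiftHomotopy

/-- Moving the basepoint along the image of `γ` is replaced by moving it along `γ` first and then
applying `f`, the form to which `ActsTrivially` applies. -/
theorem transports_map_iff {k : ℕ} [NeZero k] {X Y : Type} [TopologicalSpace X]
    [TopologicalSpace Y] (f : C(X, Y)) {x y : X} {x' y' : Y} (hx : f x = x') (hy : f y = y')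
    (γ : Path x y) {α : π_ k X x} {β : π_ k Y y'} :
    Transports (fun u => f (γ u)) (piMap k f hx α) β ↔ piMap k f hy (tr k γ α) = β := by
  subst hx hy
  rw [piMap_tr]
  exact transports_iff (γ := γ.map f.continuous)

/-- The paths `γ` and `δ` followed by the image of `γ'` have the same endpoints, so `f` does not
distinguish transport along them. -/
theorem ActsTrivially.piMap_tr_eq {k : ℕ} [NeZero k] {X X' Y : Type} [TopologicalSpace X]
    [TopologicalSpace X'] [TopologicalSpace Y] {f : C(X, Y)} (hf : ActsTrivially k f)
    (g : C(X', X)) {x b : X} {x' b' : X'} {y : Y} (hb : g b' = b) (hy : f b = y)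
    {α : π_ k X x} {α' : π_ k X' x'}
    (hα : ∃ δ : Path x (g x'), tr k δ α = piMap k g rfl α') (γ : Path x b) (γ' : Path x' b') :
    piMap k f hy (tr k γ α) =
      piMap k (f.comp g) ((congrArg f hb).trans hy) (tr k γ' α') := by
  obtain ⟨δ, hδ⟩ := hα
  subst hb hy
  rw [hf.piMap_eq rfl γ (δ.trans (γ'.map g.continuous)) α, tr_trans, hδ, ← piMap_tr, piMap_piMap]

variable {A : Type} {D : ℕ} {S : Set (Config A D)} {R : ℕ} {k : ℕ} [NeZero k]

/-- The fundamental groups of the tile complexes act trivially on the tower of their `k`-th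
homotopy groups. -/
def TowerActsTrivially (S : Set (Config A D)) (R k : ℕ) [NeZero k] : Prop :=
  ∀ r : Set.Ici R, ∃ s₀ : Set.Ici R, r ≤ s₀ ∧ ∀ (s : Set.Ici R) (_ : s₀ ≤ s) (h : r ≤ s),
    ActsTrivially k (zeta S h)

theorem piMap_zeta_tr_eq {r s s' : ℕ} (h : r ≤ s) (h' : s ≤ s') (hT : ActsTrivially k (zeta S h))
    (c : S) {y : WangComplex S s} {y' : WangComplex S s'} {α : π_ k _ y} {α' : π_ k _ y'}
    (hα : ∃ δ : Path y (zeta S h' y'), tr k δ α = piMap k (zeta S h') rfl α')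
    (γ : Path y (baseVertex c s)) (γ' : Path y' (baseVertex c s')) :
    piMap k (zeta S h) (zeta_baseVertex h c) (tr k γ α) =
      piMap k (zeta S (h.trans h')) (zeta_baseVertex _ c) (tr k γ' α') := by
  refine (hT.piMap_tr_eq (zeta S h') (zeta_baseVertex h' c) (zeta_baseVertex h c) hα γ γ').trans ?_
  exact piMap_congr (zeta_comp h h') _ _ _

/-- The common construction behind the signature and `π_k Φ`. Each index `j` offers a homomorphism
at its own range and basepoint; `hdir` says that any two are images, up to moving the basepoint, of
a third one of arbitrarily high range. The connecting path may depend on `α`, since paths become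
irrelevant after projection. -/
theorem existsUnique_hom_shiftHomotopy (hP : ∀ r, PathConnectedSpace (WangComplex S r))
    (hT : TowerActsTrivially S R k) {L J : Type} [Group L] [Nonempty J] (ρ : J → Set.Ici R)
    (y : ∀ j, WangComplex S (ρ j)) (φ : ∀ j, L →* π_ k _ (y j))
    (hdir : ∀ (s : Set.Ici R) (i j : J), ∃ m, s ≤ ρ m ∧ ∀ j' ∈ ({i, j} : Set J),
      ∃ (h : ρ j' ≤ ρ m), ∀ α, ∃ δ : Path (y j') (zeta S h (y m)),
        tr k δ (φ j' α) = piMap k (zeta S h) rfl (φ m α)) (c : S) :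
    ∃! f : L →* ShiftHomotopy S R k c, ∀ r : Set.Ici R, ∃ s₀ : Set.Ici R,
      ∀ (j : J) (_ : s₀ ≤ ρ j) (h : r ≤ ρ j) (γ : Path (y j) (baseVertex c (ρ j))) (α : L),
        Transports (fun u => zeta S h (γ u)) (piMap k (zeta S h) rfl (φ j α)) ((f α).1 r) := by
  have hex : ∀ s : Set.Ici R, ∃ j, s ≤ ρ j := fun s => by
    obtain ⟨j⟩ := ‹Nonempty J›
    obtain ⟨m, hm, -⟩ := hdir s j j
    exact ⟨m, hm⟩
  obtain ⟨γ₀⟩ : Nonempty (∀ j, Path (y j) (baseVertex c (ρ j))) :=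
    ⟨fun j => PathConnectedSpace.somePath _ _⟩
  choose s₀ hs₀ hT using hT
  choose j₀ hj₀ using fun r => hex (s₀ r)
  have hrj : ∀ r, r ≤ ρ (j₀ r) := fun r => (hs₀ r).trans (hj₀ r)
  -- The component in range `r` is computed at a chosen index beyond `s₀ r`, from which on
  -- projection to range `r` kills the action.
  let F : ∀ r : Set.Ici R, L →* π_ k (WangComplex S r) (baseVertex c r) := fun r =>
    (piMap k (zeta S (hrj r)) (zeta_baseVertex _ c)).comp ((tr k (γ₀ (j₀ r))).comp (φ (j₀ r)))
  -- Any other sufficiently high index and any path give the same value: both are compared with an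
  -- index `m` above the two.
  have key : ∀ (r : Set.Ici R) (j : J) (_ : s₀ r ≤ ρ j) (h : r ≤ ρ j)
      (γ : Path (y j) (baseVertex c (ρ j))) (α : L),
      piMap k (zeta S h) (zeta_baseVertex _ c) (tr k γ (φ j α)) = F r α := by
    intro r j hj h γ α
    obtain ⟨m, -, hm⟩ := hdir r j (j₀ r)
    obtain ⟨h1, hm1⟩ := hm j (by simp)
    obtain ⟨h2, hm2⟩ := hm (j₀ r) (by simp)
    exact (piMap_zeta_tr_eq h h1 (hT r _ hj h) c (hm1 α) γ (γ₀ m)).trans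
      (piMap_zeta_tr_eq (hrj r) h2 (hT r _ (hj₀ r) (hrj r)) c (hm2 α) (γ₀ _) (γ₀ m)).symm
  have hF : ∀ α, (fun r => F r α) ∈ ShiftHomotopy S R k c := by
    intro α r s h
    -- One index high enough for both ranges computes both components, and the maps `ζ` compose.
    obtain ⟨j, hj⟩ := hex (s₀ r ⊔ s₀ s)
    have h1 := le_sup_left.trans hj
    have h2 := le_sup_right.trans hj
    have hsj : s ≤ ρ j := (hs₀ s).trans h2
    show piMap k (zeta S h) (zeta_baseVertex h c) (F s α) = F r α
    rw [← key r j h1 (h.trans hsj) (γ₀ j) α, ← key s j h2 hsj (γ₀ j) α]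
    refine (piMap_piMap (zeta S h) (zeta S hsj) _ _ _).trans ?_
    exact piMap_congr (zeta_comp h hsj) _ _ _
  refine ⟨(MonoidHom.pi F).codRestrict _ hF, fun r => ⟨s₀ r, fun j hj h γ α => ?_⟩, ?_⟩
  · exact (transports_map_iff (zeta S h) rfl (zeta_baseVertex h c) γ).2 (key r j hj h γ α)
  · intro f hf
    refine MonoidHom.ext fun α => Subtype.ext (funext fun r => ?_)
    obtain ⟨s₁, hs₁⟩ := hf r
    obtain ⟨j, hj⟩ := hex (s₁ ⊔ s₀ r)
    have h1 := le_sup_left.trans hj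
    have h2 := le_sup_right.trans hj
    have h := (hs₀ r).trans h2
    exact ((transports_map_iff (zeta S h) rfl (zeta_baseVertex h c) (γ₀ j)).1
      (hs₁ j h1 h (γ₀ j) α)).symm.trans (key r j h2 h (γ₀ j) α)

end ShiftHomotopy

/-! ### The homotopy signature and the homotopy maps of a cellular automaton -/

section Signature

variable {A : Type} {D : ℕ} {S : Set (Config A D)} {R : ℕ} {a : Config A D} {k : ℕ} [NeZero k]
  {ω : ℝ≥0 → Fin D → ℝ}

theorem IsBaseRay.exists_staysFrom (hω : IsBaseRay S a ω) (r : ℕ) (t₀ : ℝ≥0) :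
    ∃ t, t₀ ≤ t ∧ StaysFrom S a ω r t := by
  obtain ⟨t, ht⟩ := Filter.eventually_atTop.1 (hω.eventually r)
  exact ⟨t ⊔ t₀, le_sup_right, fun t' ht' => ht t' (le_sup_left.trans ht')⟩

theorem StaysFrom.of_le {r s : ℕ} {t t' : ℝ≥0} (h : StaysFrom S a ω s t) (hr : r ≤ s)
    (ht : t ≤ t') : StaysFrom S a ω r t' :=
  fun t'' ht'' => realization_mono (unflawed_anti S a hr) (h t'' (ht.trans ht''))

/-- The segment of a ray, as a path in `𝐆_r(a)`. -/
def rayPath (hω : Continuous ω) {r : ℕ} {t t' : ℝ≥0} (h : StaysFrom S a ω r t) (ht : t ≤ t') :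
    Path (rayPt h) (rayPt (h.of_le le_rfl ht)) where
  toFun := raySegment h t'
  continuous_toFun := by
    unfold raySegment
    fun_prop
  source' := Subtype.ext (by simp [raySegment, rayPt])
  target' := Subtype.ext (by
    show ω _ = ω _
    simp [add_tsub_cancel_of_le ht])

/-- The relation between the components of an element of `π_k[𝔾_∞(a), ω]`. -/
theorem DefectHomotopy.tr_rayPath {hω : Continuous ω} (α : DefectHomotopy S R a k hω)
    (i j : RayIndex S R a ω) (h : i.r ≤ j.r) (ht : i.t ≤ j.t) :
    tr k (rayPath hω i.stays ht) (α.1 i) =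
      piMap k (unflawedIncl S a h) (x := rayPt j.stays) rfl (α.1 j) :=
  (transports_iff (γ := rayPath hω i.stays ht)).1 (α.2 i j h ht)

/-- A commuting square of spaces carries the relation "equal up to moving the basepoint" from its
source side to its target side. It is used for inclusions of unflawed regions against restrictions
of labels. -/
theorem exists_path_of_square {X X' Y Y' : Type} [TopologicalSpace X] [TopologicalSpace X']
    [TopologicalSpace Y] [TopologicalSpace Y'] {f : C(X, Y)} {f' : C(X', Y')} {u : C(X', X)}
    {v : C(Y', Y)} (h : v.comp f' = f.comp u) {x : X} {x' : X'} {α : π_ k X x} {α' : π_ k X' x'}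
    (γ : Path x (u x')) (hγ : tr k γ α = piMap k u rfl α') :
    ∃ δ : Path (f x) (v (f' x')),
      tr k δ (piMap k f rfl α) = piMap k v rfl (piMap k f' rfl α') := by
  have e : v (f' x') = f (u x') := DFunLike.congr_fun h x'
  refine ⟨(γ.map f.continuous).cast rfl e, (tr_cast _ rfl e _ _).2 ?_⟩
  have h1 := (transports_tr γ α).map f rfl e.symm
  rw [hγ, piMap_piMap] at h1
  rw [piMap_piMap, piMap_congr h rfl e.symm]
  exact h1

theorem DefectHomotopy.exists_path_sec {hω : Continuous ω} (α : DefectHomotopy S R a k hω)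
    (i j : RayIndex S R a ω) (h : i.r ≤ j.r) (ht : i.t ≤ j.t) :
    ∃ δ : Path (sec S a i.r (rayPt i.stays)) (zeta S h (sec S a j.r (rayPt j.stays))),
      tr k δ (piMap k (sec S a i.r) rfl (α.1 i)) =
        piMap k (zeta S h) rfl (piMap k (sec S a j.r) rfl (α.1 j)) :=
  exists_path_of_square (zeta_comp_sec a h) (rayPath hω i.stays ht)
    (DefectHomotopy.tr_rayPath α i j h ht)

theorem existsUnique_isHomotopySignature (hP : ∀ r, PathConnectedSpace (WangComplex S r))
    (hT : TowerActsTrivially S R k) (hω : IsBaseRay S a ω) (c : S) :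
    ∃! f : DefectHomotopy S R a k hω.continuous →* ShiftHomotopy S R k c,
      IsHomotopySignature c f := by
  have : Nonempty (RayIndex S R a ω) := by
    obtain ⟨t, -, ht⟩ := hω.exists_staysFrom R 0
    exact ⟨⟨⟨R, le_refl R⟩, t, ht⟩⟩
  have h := existsUnique_hom_shiftHomotopy hP hT (fun j : RayIndex S R a ω => j.r)
    (fun j => sec S a j.r (rayPt j.stays))
    (fun j => (piMap k (sec S a j.r) rfl).comp
      ((Pi.evalMonoidHom _ j).comp (DefectHomotopy S R a k hω.continuous).subtype))
    (fun s i j => by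
      -- A common upper index needs a range above all three and a time late enough for the ray to
      -- stay in that region.
      obtain ⟨t, ht, hst⟩ := hω.exists_staysFrom (s ⊔ (i.r ⊔ j.r) : Set.Ici R) (i.t ⊔ j.t)
      refine ⟨⟨s ⊔ (i.r ⊔ j.r), t, hst⟩, le_sup_left, ?_⟩
      rintro j' (rfl | rfl)
      · exact ⟨le_sup_left.trans le_sup_right,
          fun α => DefectHomotopy.exists_path_sec α _ ⟨_, t, hst⟩ _ (le_sup_left.trans ht)⟩
      · exact ⟨le_sup_right.trans le_sup_right,
          fun α => DefectHomotopy.exists_path_sec α _ ⟨_, t, hst⟩ _ (le_sup_right.trans ht)⟩) c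
  have e : ∀ (α : DefectHomotopy S R a k hω.continuous) (j : RayIndex S R a ω) {r : Set.Ici R}
      (h : r ≤ j.r), piMap k ((zeta S h).comp (sec S a j.r)) rfl (α.1 j) =
        piMap k (zeta S h) rfl (piMap k (sec S a j.r) rfl (α.1 j)) := fun α j _ h =>
    (piMap_piMap (zeta S h) (sec S a j.r) rfl rfl (α.1 j)).symm
  refine (existsUnique_congr fun f => ?_).1 h
  refine forall_congr' fun r => exists_congr fun s₀ => forall_congr' fun j =>
    forall_congr' fun hj => forall_congr' fun h => forall_congr' fun γ => forall_congr' fun α => ?_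
  rw [e α j h]
  rfl

variable [TopologicalSpace A] {Φ : Config A D → Config A D} (hΦ : IsCellularAutomaton Φ)
  (hS : Set.MapsTo Φ S S)

/-- Enlarging the radius only inserts a restriction map, which the compatible family `β` absorbs. -/
theorem piMap_wangMap_of_le {q q' : ℕ} (hq : HasRadius Φ q) (hq' : HasRadius Φ q') (h : q ≤ q')
    {c : S} (β : ShiftHomotopy S R k c) (s : Set.Ici R) :
    piMap k (wangMap hΦ hS hq' s) (wangMap_baseVertex hΦ hS hq' s c) (β.1 (addIdx s q')) =
      piMap k (wangMap hΦ hS hq s) (wangMap_baseVertex hΦ hS hq s c) (β.1 (addIdx s q)) := by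
  refine Eq.symm ?_
  refine (congrArg (piMap k (wangMap hΦ hS hq s) (wangMap_baseVertex hΦ hS hq s c))
    (β.2 (addIdx s q) (addIdx s q') (Nat.add_le_add_left h s.1)).symm).trans ?_
  refine (piMap_piMap (wangMap hΦ hS hq s) (zeta S (Nat.add_le_add_left h s.1)) _ _ _).trans ?_
  exact (piMap_congr (wangMap_eq_comp_zeta hΦ hS hq hq' h s) _ _ _).symm

theorem piMap_wangMap_eq {q q' : ℕ} (hq : HasRadius Φ q) (hq' : HasRadius Φ q')
    {c : S} (β : ShiftHomotopy S R k c) (s : Set.Ici R) :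
    piMap k (wangMap hΦ hS hq' s) (wangMap_baseVertex hΦ hS hq' s c) (β.1 (addIdx s q')) =
      piMap k (wangMap hΦ hS hq s) (wangMap_baseVertex hΦ hS hq s c) (β.1 (addIdx s q)) := by
  rcases le_total q q' with h | h
  · exact piMap_wangMap_of_le hΦ hS hq hq' h β s
  · exact (piMap_wangMap_of_le hΦ hS hq' hq h β s).symm

theorem piMap_zeta_wangMap {q : ℕ} (hq : HasRadius Φ q) {c : S} (β : ShiftHomotopy S R k c)
    {s t : Set.Ici R} (h : s ≤ t) :
    piMap k (zeta S h) (zeta_baseVertex h _)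
        (piMap k (wangMap hΦ hS hq t) (wangMap_baseVertex hΦ hS hq t c) (β.1 (addIdx t q))) =
      piMap k (wangMap hΦ hS hq s) (wangMap_baseVertex hΦ hS hq s c) (β.1 (addIdx s q)) := by
  refine (piMap_piMap (zeta S h) (wangMap hΦ hS hq t) _ _ _).trans (Eq.symm ?_)
  refine (congrArg (piMap k (wangMap hΦ hS hq s) (wangMap_baseVertex hΦ hS hq s c))
    (β.2 (addIdx s q) (addIdx t q) (Nat.add_le_add_right h q)).symm).trans ?_
  refine (piMap_piMap (wangMap hΦ hS hq s) (zeta S (Nat.add_le_add_right h q)) _ _ _).trans ?_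
  exact (piMap_congr (zeta_comp_wangMap hΦ hS hq h) _ _ _).symm

theorem existsUnique_isHomotopyCAMap (hP : ∀ r, PathConnectedSpace (WangComplex S r))
    (hT : TowerActsTrivially S R k) {q₀ : ℕ} (hq₀ : HasRadius Φ q₀) (c c' : S) :
    ∃! f : ShiftHomotopy S R k c →* ShiftHomotopy S R k c',
      IsHomotopyCAMap hΦ hS c c' f := by
  have : Nonempty (Set.Ici R) := ⟨⟨R, le_refl R⟩⟩
  have h := existsUnique_hom_shiftHomotopy hP hT (fun s : Set.Ici R => s)
    (fun s => baseVertex (⟨Φ c, hS c.2⟩ : S) s)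
    (fun s => (piMap k (wangMap hΦ hS hq₀ s) (wangMap_baseVertex hΦ hS hq₀ s c)).comp
      ((Pi.evalMonoidHom _ (addIdx s q₀)).comp (ShiftHomotopy S R k c).subtype))
    (fun s i j => by
      refine ⟨s ⊔ (i ⊔ j), le_sup_left, ?_⟩
      rintro j' (rfl | rfl)
      · exact ⟨le_sup_left.trans le_sup_right, fun β =>
          -- The vertices `x_s(Φ(c))` are compatible under `ζ`, so no path is needed to compare
          -- ranges.
          ⟨Path.refl _, (tr_refl _).trans (piMap_zeta_wangMap hΦ hS hq₀ β _).symm⟩⟩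
      · exact ⟨le_sup_right.trans le_sup_right, fun β =>
          ⟨Path.refl _, (tr_refl _).trans (piMap_zeta_wangMap hΦ hS hq₀ β _).symm⟩⟩) c'
  have e : ∀ {q : ℕ} (hq : HasRadius Φ q) (β : ShiftHomotopy S R k c) {r s : Set.Ici R}
      (h : r ≤ s), piMap k ((zeta S h).comp (wangMap hΦ hS hq s))
        (congrArg (zeta S h) (wangMap_baseVertex hΦ hS hq s c)) (β.1 (addIdx s q)) =
      piMap k (zeta S h) rfl (piMap k (wangMap hΦ hS hq₀ s)
        (wangMap_baseVertex hΦ hS hq₀ s c) (β.1 (addIdx s q₀))) := fun hq β _ s h =>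
    (piMap_piMap (zeta S h) (wangMap hΦ hS hq s) (wangMap_baseVertex hΦ hS hq s c) rfl
      (β.1 (addIdx s _))).symm.trans
      (congrArg (piMap k (zeta S h) rfl) (piMap_wangMap_eq hΦ hS hq₀ hq β s))
  refine (existsUnique_congr fun f => ?_).1 h
  constructor
  · intro hf q hq r
    obtain ⟨s₀, hs₀⟩ := hf r
    refine ⟨s₀, fun s hs h γ β => ?_⟩
    rw [e hq β h]
    exact hs₀ s hs h γ β
  · intro hf r
    obtain ⟨s₀, hs₀⟩ := hf q₀ hq₀ r
    refine ⟨s₀, fun s hs h γ β => ?_⟩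
    have := hs₀ s hs h γ β
    rw [e hq₀ β h] at this
    exact this

end Signature

/-! ### The inclusion of unflawed regions on proper homotopy groups -/

section HomotopyInclusion

variable {A : Type} {D : ℕ} {S : Set (Config A D)} {R : ℕ} {a : Config A D} {k : ℕ} [NeZero k]
  {ω : ℝ≥0 → Fin D → ℝ}

/-- The linear path between two nonnegative numbers. -/
def nnrealPath {t t' : ℝ≥0} (ht : t ≤ t') : Path (t : ℝ) t' where
  toFun u := (t + unitInterval.toNNReal u * (t' - t) : ℝ≥0)
  continuous_toFun := by fun_prop
  source' := by simp
  target' := by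
    rw [NNReal.coe_inj]
    simp [add_tsub_cancel_of_le ht]

/-- The tail of a ray, as a map on `ℝ`. -/
def rayTail (hω : Continuous ω) {r : ℕ} {t : ℝ≥0} (h : StaysFrom S a ω r t) :
    C(ℝ, Unflawed S a r) :=
  ⟨fun v => ⟨ω (t ⊔ v.toNNReal), h _ le_sup_left⟩, by fun_prop⟩

theorem rayTail_coe (hω : Continuous ω) {r : ℕ} {t t' : ℝ≥0} (h : StaysFrom S a ω r t)
    (ht : t ≤ t') : rayTail hω h t' = rayPt (h.of_le le_rfl ht) :=
  Subtype.ext (congrArg ω (by rw [Real.toNNReal_coe, sup_eq_right.2 ht]))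

/-- Both paths are images under the tail of the ray of paths in `ℝ` with equal endpoints, and `ℝ` is
simply connected. -/
theorem homotopic_rayPath_trans (hω : Continuous ω) {r : ℕ} {t t' t'' : ℝ≥0}
    (h : StaysFrom S a ω r t) (ht : t ≤ t') (ht' : t' ≤ t'') :
    (rayPath hω h (ht.trans ht')).Homotopic
      ((rayPath hω h ht).trans (rayPath hω (h.of_le le_rfl ht) ht')) := by
  have hx : rayPt h = rayTail hω h t := (rayTail_coe hω h le_rfl).symm
  have hy : rayPt (h.of_le le_rfl (ht.trans ht')) = rayTail hω h t'' :=
    (rayTail_coe hω h (ht.trans ht')).symm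
  have h1 := ((SimplyConnectedSpace.paths_homotopic (nnrealPath (ht.trans ht'))
    ((nnrealPath ht).trans (nnrealPath ht'))).map (rayTail hω h)).pathCast hx hy
  have e1 : rayPath hω h (ht.trans ht') =
      ((nnrealPath (ht.trans ht')).map (rayTail hω h).continuous).cast hx hy :=
    Path.ext (funext fun u => (rayTail_coe hω h le_self_add).symm)
  have e2 : (rayPath hω h ht).trans (rayPath hω (h.of_le le_rfl ht) ht') =
      (((nnrealPath ht).trans (nnrealPath ht')).map (rayTail hω h).continuous).cast hx hy := by
    refine Path.ext (funext fun u => ?_)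
    rw [Path.cast_coe, Path.map_coe, Function.comp_apply, Path.trans_apply, Path.trans_apply]
    split_ifs
    · exact (rayTail_coe hω h le_self_add).symm
    · exact (rayTail_coe hω h (ht.trans le_self_add)).symm
  rw [e1, e2]
  exact h1

theorem tr_rayPath_tr (hω : Continuous ω) {r : ℕ} {t t' t'' : ℝ≥0}
    (h : StaysFrom S a ω r t) (ht : t ≤ t') (ht' : t' ≤ t'') (α : π_ k _ (rayPt h)) :
    tr k (rayPath hω (h.of_le le_rfl ht) ht') (tr k (rayPath hω h ht) α) =
      tr k (rayPath hω h (ht.trans ht')) α := by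
  rw [tr_congr (homotopic_rayPath_trans hω h ht ht')]
  exact (tr_trans _ _ α).symm

theorem tr_rayPath_self (hω : Continuous ω) {r : ℕ} {t : ℝ≥0} (h : StaysFrom S a ω r t)
    (α : π_ k _ (rayPt h)) : tr k (rayPath hω h le_rfl) α = α := by
  have e : rayPath hω h le_rfl = Path.refl (rayPt h) := by
    ext1
    funext u
    exact Subtype.ext (congrArg ω (by simp))
  rw [e, tr_refl]

theorem tr_injective {X : Type} [TopologicalSpace X] {x y : X} (γ : Path x y) :
    Function.Injective (tr k γ) :=
  Function.LeftInverse.injective (tr_symm_tr γ)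

theorem DefectHomotopy.piMap_unflawedIncl {hω : Continuous ω} (α : DefectHomotopy S R a k hω)
    {r s : Set.Ici R} (h : r ≤ s) {t : ℝ≥0} (hs : StaysFrom S a ω s t)
    (hr : StaysFrom S a ω r t) :
    piMap k (unflawedIncl S a h) (x := rayPt hs) (y := rayPt hr) rfl (α.1 ⟨s, t, hs⟩) =
      α.1 ⟨r, t, hr⟩ :=
  (DefectHomotopy.tr_rayPath α ⟨r, t, hr⟩ ⟨s, t, hs⟩ h le_rfl).symm.trans
    (tr_rayPath_self hω hr _)

theorem piMap_unflawedIncl_tr (hω : Continuous ω) {r s : ℕ} (hrs : r ≤ s) {t t' : ℝ≥0}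
    (h : StaysFrom S a ω s t) (h' : StaysFrom S a ω r t) (ht : t ≤ t') (α : π_ k _ (rayPt h)) :
    piMap k (unflawedIncl S a hrs) (y := rayPt (h'.of_le le_rfl ht)) rfl
        (tr k (rayPath hω h ht) α) =
      tr k (rayPath hω h' ht) (piMap k (unflawedIncl S a hrs) (y := rayPt h') rfl α) :=
  (Transports.tr_eq (γ := rayPath hω h' ht)
    ((transports_tr (rayPath hω h ht) α).map (unflawedIncl S a hrs) rfl rfl)).symm

/-! ### The effect of a cellular automaton on proper homotopy groups -/

variable [TopologicalSpace A] {Φ : Config A D → Config A D} (hΦ : IsCellularAutomaton Φ)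
  (hS : Set.MapsTo Φ S S)

include hΦ hS in
theorem IsBaseRay.image {q : ℕ} (hq : HasRadius Φ q) (hω : IsBaseRay S a ω) :
    IsBaseRay S (Φ a) ω :=
  ⟨hω.continuous, hω.tendsto, fun r => (hω.eventually (r + q)).mono fun _ ht =>
    realization_mono (unflawed_subset hΦ hS hq a r) ht⟩

/-- The image under `𝐆_{r+q}(a) ⊆ 𝐆_r(Φ(a))` of a component of an element of `π_k[𝔾_∞(a), ω]`. -/
def inclComponent {q : ℕ} (hq : HasRadius Φ q) {hω : Continuous ω} (r : Set.Ici R) {t : ℝ≥0}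
    (h : StaysFrom S a ω (addIdx r q) t) :
    DefectHomotopy S R a k hω →* π_ k (Unflawed S (Φ a) r) (rayPt (h.image hΦ hS hq)) :=
  (piMap k (defectIncl hΦ hS hq a r) (x := rayPt h) rfl).comp
    ((Pi.evalMonoidHom _ (⟨addIdx r q, t, h⟩ : RayIndex S R a ω)).comp
      (DefectHomotopy S R a k hω).subtype)

/-- The inclusion carries ray segments to ray segments, so moving along the ray can be done before
it, where the family `α` is compatible. -/
theorem tr_rayPath_inclComponent {q : ℕ} (hq : HasRadius Φ q) {hω : Continuous ω}
    (r : Set.Ici R) {t t' : ℝ≥0} (h : StaysFrom S a ω (addIdx r q) t)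
    (h' : StaysFrom S a ω (addIdx r q) t') (ht : t ≤ t') (α : DefectHomotopy S R a k hω) :
    tr k (rayPath hω (h.image hΦ hS hq) ht) (inclComponent hΦ hS hq r h α) =
      inclComponent hΦ hS hq r h' α := by
  have h1 := (transports_tr (rayPath hω h ht) (α.1 ⟨addIdx r q, t, h⟩)).map
    (defectIncl hΦ hS hq a r) (x' := rayPt (h.image hΦ hS hq))
    (y' := rayPt (h'.image hΦ hS hq)) rfl rfl
  refine (Transports.tr_eq (γ := rayPath hω (h.image hΦ hS hq) ht) h1).trans ?_
  refine congrArg (piMap k (defectIncl hΦ hS hq a r) rfl) ?_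
  refine (DefectHomotopy.tr_rayPath α ⟨addIdx r q, t, h⟩ ⟨addIdx r q, t', h'⟩ le_rfl ht).trans ?_
  exact DefectHomotopy.piMap_unflawedIncl α le_rfl h' h'

theorem inclComponent_of_le {q q' : ℕ} (hq : HasRadius Φ q) (hq' : HasRadius Φ q') (hqq : q ≤ q')
    {hω : Continuous ω} (r : Set.Ici R) {t : ℝ≥0} (h : StaysFrom S a ω (addIdx r q) t)
    (h' : StaysFrom S a ω (addIdx r q') t) (α : DefectHomotopy S R a k hω) :
    inclComponent hΦ hS hq' r h' α = inclComponent hΦ hS hq r h α := by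
  have hi : addIdx r q ≤ addIdx r q' := Nat.add_le_add_left hqq r.1
  refine Eq.trans ?_ (congrArg (piMap k (defectIncl hΦ hS hq a r) (x := rayPt h) rfl)
    (DefectHomotopy.piMap_unflawedIncl α hi h' h))
  refine Eq.trans ?_ (piMap_piMap (defectIncl hΦ hS hq a r) (unflawedIncl S a hi) _ _ _).symm
  exact piMap_congr (defectIncl_eq_comp_unflawedIncl hΦ hS hq hq' hqq a r) _ _ _

theorem piMap_inclComponent {q : ℕ} (hq : HasRadius Φ q) {hω : Continuous ω} {r s : Set.Ici R}
    (hrs : r ≤ s) {t : ℝ≥0} (h : StaysFrom S a ω (addIdx r q) t)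
    (h' : StaysFrom S a ω (addIdx s q) t) (α : DefectHomotopy S R a k hω) :
    piMap k (unflawedIncl S (Φ a) hrs) (y := rayPt (h.image hΦ hS hq)) rfl
      (inclComponent hΦ hS hq s h' α) = inclComponent hΦ hS hq r h α := by
  have hi : addIdx r q ≤ addIdx s q := Nat.add_le_add_right hrs q
  refine Eq.trans ?_ (congrArg (piMap k (defectIncl hΦ hS hq a r) (x := rayPt h) rfl)
    (DefectHomotopy.piMap_unflawedIncl α hi h' h))
  refine (piMap_piMap (unflawedIncl S (Φ a) hrs) (defectIncl hΦ hS hq a s) _ _ _).trans ?_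
  refine Eq.trans ?_ (piMap_piMap (defectIncl hΦ hS hq a r) (unflawedIncl S a hi) _ _ _).symm
  exact piMap_congr (unflawedIncl_comp_defectIncl hΦ hS hq a hrs) _ _ _

/-- The ray may settle in `𝐆_r(Φ(a))` earlier than in `𝐆_{r+q}(a)`, so an index of the target need
not come from one of the source. The component is therefore taken at a later time `T i` and moved
back along the ray. Identities are checked after moving forward to a common later time, which loses
nothing because `tr` is injective. -/
theorem existsUnique_isHomotopyInclusion {q₀ : ℕ} (hq₀ : HasRadius Φ q₀)
    (hω : IsBaseRay S a ω) :
    ∃! f : DefectHomotopy S R a k hω.continuous →* DefectHomotopy S R (Φ a) k hω.continuous,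
      IsHomotopyInclusion hΦ hS f := by
  have hex : ∀ i : RayIndex S R (Φ a) ω, ∃ t, i.t ≤ t ∧ StaysFrom S a ω (addIdx i.r q₀) t :=
    fun i => hω.exists_staysFrom _ _
  choose T hT hstay using hex
  let F : ∀ i : RayIndex S R (Φ a) ω, DefectHomotopy S R a k hω.continuous →*
      π_ k (Unflawed S (Φ a) i.r) (rayPt i.stays) := fun i =>
    (tr k (rayPath hω.continuous i.stays (hT i)).symm).comp
      (inclComponent hΦ hS hq₀ i.r (hstay i))
  have key : ∀ (i : RayIndex S R (Φ a) ω) (t : ℝ≥0) (h : StaysFrom S a ω (addIdx i.r q₀) t)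
      (ht : i.t ≤ t) (α : DefectHomotopy S R a k hω.continuous),
      tr k (rayPath hω.continuous i.stays ht) (F i α) = inclComponent hΦ hS hq₀ i.r h α := by
    intro i t h ht α
    -- The times `t` and `T i` are not comparable a priori, so the comparison takes place at their
    -- maximum.
    have h' : StaysFrom S a ω (addIdx i.r q₀) (t ⊔ T i) := h.of_le le_rfl le_sup_left
    refine tr_injective (rayPath hω.continuous (i.stays.of_le le_rfl ht)
      (le_sup_left : t ≤ t ⊔ T i)) ?_
    rw [tr_rayPath_tr]
    refine Eq.trans ?_ (tr_rayPath_inclComponent hΦ hS hq₀ i.r h h' le_sup_left α).symm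
    refine (tr_rayPath_tr hω.continuous i.stays (hT i) (le_sup_right : T i ≤ t ⊔ T i)
      (F i α)).symm.trans ?_
    refine Eq.trans ?_ (tr_rayPath_inclComponent hΦ hS hq₀ i.r (hstay i) h' le_sup_right α)
    exact congrArg _ (tr_tr_symm (rayPath hω.continuous i.stays (hT i)) _)
  have hF : ∀ α, (fun i => F i α) ∈ DefectHomotopy S R (Φ a) k hω.continuous := by
    intro α i j h ht
    refine (transports_iff (γ := rayPath hω.continuous i.stays ht)).2 ?_
    -- Time `T j` serves both indices, since the higher range of `j` has the smaller unflawed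
    -- region.
    have h' : StaysFrom S a ω (addIdx i.r q₀) (T j) :=
      (hstay j).of_le (Nat.add_le_add_right h q₀) le_rfl
    refine tr_injective (rayPath hω.continuous (i.stays.of_le le_rfl ht) (hT j)) ?_
    refine (tr_rayPath_tr hω.continuous i.stays ht (hT j) (F i α)).trans ?_
    rw [key i (T j) h' (ht.trans (hT j)) α]
    refine Eq.trans ?_ (piMap_unflawedIncl_tr hω.continuous h j.stays
      (i.stays.of_le le_rfl ht) (hT j) (F j α))
    rw [key j (T j) (hstay j) (hT j) α]
    exact (piMap_inclComponent hΦ hS hq₀ h h' (hstay j) α).symm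
  have hind : ∀ {q : ℕ} (hq : HasRadius Φ q) (r : Set.Ici R) (t : ℝ≥0)
      (h : StaysFrom S a ω (addIdx r q) t) (h₀ : StaysFrom S a ω (addIdx r q₀) t)
      (α : DefectHomotopy S R a k hω.continuous),
      inclComponent hΦ hS hq₀ r h₀ α = inclComponent hΦ hS hq r h α := by
    intro q hq r t h h₀ α
    rcases le_total q q₀ with hqq | hqq
    · exact inclComponent_of_le hΦ hS hq hq₀ hqq r h h₀ α
    · exact (inclComponent_of_le hΦ hS hq₀ hq hqq r h₀ h α).symm
  refine ⟨(MonoidHom.pi F).codRestrict _ hF, fun q hq r t h α => ?_, fun f hf => ?_⟩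
  · let i : RayIndex S R (Φ a) ω := ⟨r, t, h.image hΦ hS hq⟩
    -- At time `T i` the ray stays in the regions for both radii `q` and `q₀`, so `hind` applies
    -- there.
    have h' : StaysFrom S a ω (addIdx r q) (T i) := h.of_le le_rfl (hT i)
    refine tr_injective (rayPath hω.continuous i.stays (hT i)) ?_
    refine (key i (T i) (hstay i) (hT i) α).trans ?_
    refine (hind hq r _ h' (hstay i) α).trans ?_
    exact (tr_rayPath_inclComponent hΦ hS hq r h h' (hT i) α).symm
  · refine MonoidHom.ext fun α => Subtype.ext (funext fun i => ?_)
    refine tr_injective (rayPath hω.continuous i.stays (hT i)) ?_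
    refine Eq.trans ?_ (key i (T i) (hstay i) (hT i) α).symm
    refine (DefectHomotopy.tr_rayPath (f α) i
      ⟨i.r, T i, i.stays.of_le le_rfl (hT i)⟩ le_rfl (hT i)).trans ?_
    refine (DefectHomotopy.piMap_unflawedIncl (f α) le_rfl (i.stays.of_le le_rfl (hT i))
      (i.stays.of_le le_rfl (hT i))).trans ?_
    exact hf q₀ hq₀ i.r (T i) (hstay i) α

end HomotopyInclusion

/-! ### The commuting square of homotopy groups -/

section HomotopySquare

variable {A : Type} {D : ℕ} {S : Set (Config A D)} {R : ℕ} {a : Config A D} {k : ℕ} [NeZero k]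
  {ω : ℝ≥0 → Fin D → ℝ}

/-- The defining property concerns only high ranges and all paths. Projecting down gives a statement
valid in every range, at the price of knowing only that some path works. -/
theorem IsHomotopySignature.exists_path (hP : ∀ r, PathConnectedSpace (WangComplex S r))
    (hω : IsBaseRay S a ω) {c : S}
    {f : DefectHomotopy S R a k hω.continuous →* ShiftHomotopy S R k c}
    (hf : IsHomotopySignature c f) (α : DefectHomotopy S R a k hω.continuous)
    (i : RayIndex S R a ω) :
    ∃ δ : Path (sec S a i.r (rayPt i.stays)) (baseVertex c i.r),
      tr k δ (piMap k (sec S a i.r) rfl (α.1 i)) = (f α).1 i.r := by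
  obtain ⟨s₀, hs₀⟩ := hf i.r
  obtain ⟨t, ht, hst⟩ := hω.exists_staysFrom (s₀ ⊔ i.r : Set.Ici R) i.t
  let j : RayIndex S R a ω := ⟨s₀ ⊔ i.r, t, hst⟩
  have h : i.r ≤ j.r := le_sup_right
  let γ : Path (sec S a j.r (rayPt j.stays)) (baseVertex c j.r) := PathConnectedSpace.somePath _ _
  have h1 := hs₀ j le_sup_left h γ α
  obtain ⟨δ, hδ⟩ := DefectHomotopy.exists_path_sec α i j h ht
  let γ' : Path (zeta S h (sec S a j.r (rayPt j.stays))) (baseVertex c i.r) :=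
    γ.map (zeta S h).continuous
  refine ⟨δ.trans γ', ?_⟩
  rw [tr_trans, hδ, piMap_piMap]
  exact Transports.tr_eq (γ := γ') h1

theorem exists_path_tr_piMap {X Y : Type} [TopologicalSpace X] [TopologicalSpace Y] (f : C(X, Y))
    {x x' : X} {y y' y'' : Y} (hx : f x = y) (hx' : f x' = y') (δ : Path x x') (γ : Path y' y'')
    (α : π_ k X x) :
    ∃ ε : Path y y'', tr k γ (piMap k f hx' (tr k δ α)) = tr k ε (piMap k f hx α) := by
  subst hx hx'
  exact ⟨(δ.map f.continuous).trans γ, by rw [tr_trans, piMap_tr]⟩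

variable [TopologicalSpace A] {Φ : Config A D → Config A D} {hΦ : IsCellularAutomaton Φ}
  {hS : Set.MapsTo Φ S S}

theorem IsHomotopyCAMap.exists_path (hP : ∀ r, PathConnectedSpace (WangComplex S r)) {c c' : S}
    {f : ShiftHomotopy S R k c →* ShiftHomotopy S R k c'} (hf : IsHomotopyCAMap hΦ hS c c' f)
    {q : ℕ} (hq : HasRadius Φ q) (β : ShiftHomotopy S R k c) (r : Set.Ici R) :
    ∃ δ : Path (baseVertex (⟨Φ c, hS c.2⟩ : S) r) (baseVertex c' r),
      tr k δ (piMap k (wangMap hΦ hS hq r) (wangMap_baseVertex hΦ hS hq r c)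
        (β.1 (addIdx r q))) = (f β).1 r := by
  obtain ⟨s₀, hs₀⟩ := hf q hq r
  let s : Set.Ici R := s₀ ⊔ r
  have h : r ≤ s := le_sup_right
  let γ : Path (baseVertex (⟨Φ c, hS c.2⟩ : S) s) (baseVertex c' s) :=
    PathConnectedSpace.somePath _ _
  have h1 := hs₀ s le_sup_left h γ β
  let γ' : Path (baseVertex (⟨Φ c, hS c.2⟩ : S) r) (baseVertex c' r) :=
    γ.map (zeta S h).continuous
  refine ⟨γ', ?_⟩
  rw [← piMap_zeta_wangMap hΦ hS hq β h]
  refine Eq.trans (congrArg (tr k γ') ?_) (Transports.tr_eq (γ := γ') h1)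
  exact piMap_piMap (zeta S h) (wangMap hΦ hS hq s) _ _ _

/-- In a range `s` from which the action on range `r` is killed, both composites arise from the same
class, the image of `α` under the section of `Φ a`, by moving the basepoint along two possibly
different paths. Their projections to range `r` therefore agree. -/
theorem homotopy_square (hP : ∀ r, PathConnectedSpace (WangComplex S r))
    (hT : TowerActsTrivially S R k) {q : ℕ} (hq : HasRadius Φ q) (hω : IsBaseRay S a ω) {c c' : S}
    {πa : DefectHomotopy S R a k hω.continuous →* ShiftHomotopy S R k c}
    {πb : DefectHomotopy S R (Φ a) k hω.continuous →* ShiftHomotopy S R k c'}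
    {πι : DefectHomotopy S R a k hω.continuous →* DefectHomotopy S R (Φ a) k hω.continuous}
    {πΦ : ShiftHomotopy S R k c →* ShiftHomotopy S R k c'}
    (ha : IsHomotopySignature c πa) (hb : IsHomotopySignature c' πb)
    (hι : IsHomotopyInclusion hΦ hS πι) (hc : IsHomotopyCAMap hΦ hS c c' πΦ) :
    πb.comp πι = πΦ.comp πa := by
  refine MonoidHom.ext fun α => Subtype.ext (funext fun r => ?_)
  obtain ⟨s, hs, hT⟩ := hT r
  obtain ⟨t, -, ht⟩ := hω.exists_staysFrom (addIdx s q : Set.Ici R) 0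
  have hω' : IsBaseRay S (Φ a) ω := hω.image hΦ hS hq
  let i : RayIndex S R a ω := ⟨addIdx s q, t, ht⟩
  let j : RayIndex S R (Φ a) ω := ⟨s, t, ht.image hΦ hS hq⟩
  obtain ⟨γb, hγb⟩ := IsHomotopySignature.exists_path hP hω' hb (πι α) j
  obtain ⟨γa, hγa⟩ := IsHomotopySignature.exists_path hP hω ha α i
  obtain ⟨γΦ, hγΦ⟩ := IsHomotopyCAMap.exists_path hP hc hq (πa α) s
  have e : wangMap hΦ hS hq s (sec S a (addIdx s q) (rayPt ht)) =
      sec S (Φ a) s (rayPt j.stays) :=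
    (DFunLike.congr_fun (sec_comp_defectIncl hΦ hS hq a s) (rayPt ht)).symm
  obtain ⟨γ, hγ⟩ := exists_path_tr_piMap (wangMap hΦ hS hq s) e
    (wangMap_baseVertex hΦ hS hq s c) γa γΦ (piMap k (sec S a (addIdx s q)) rfl (α.1 i))
  have e1 : piMap k (wangMap hΦ hS hq s) e (piMap k (sec S a (addIdx s q)) rfl (α.1 i)) =
      piMap k (sec S (Φ a) s) rfl ((πι α).1 j) := by
    refine Eq.trans ?_ (congrArg (piMap k (sec S (Φ a) s) rfl) (hι q hq s t ht α)).symm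
    refine (piMap_piMap (wangMap hΦ hS hq s) (sec S a (addIdx s q)) _ _ _).trans ?_
    refine Eq.trans ?_ (piMap_piMap (sec S (Φ a) s) (defectIncl hΦ hS hq a s) _ _ _).symm
    exact (piMap_congr (sec_comp_defectIncl hΦ hS hq a s) _ _ _).symm
  -- The detour through `π_k a` and `Φ_*` amounts to a single path `γ` in `𝐗_s`, namely the image of
  -- `γa` followed by `γΦ`.
  have e2 : (πΦ (πa α)).1 s = tr k γ (piMap k (sec S (Φ a) s) rfl ((πι α).1 j)) := by
    rw [← hγΦ, ← e1, ← hγ]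
    exact congrArg (fun x => tr k γΦ (piMap k (wangMap hΦ hS hq s)
      (wangMap_baseVertex hΦ hS hq s c) x)) hγa.symm
  show (πb (πι α)).1 r = (πΦ (πa α)).1 r
  rw [← (πb (πι α)).2 r s hs, ← (πΦ (πa α)).2 r s hs, e2]
  refine (congrArg (piMap k (zeta S hs) (zeta_baseVertex hs c')) hγb.symm).trans ?_
  exact (hT s le_rfl hs).piMap_eq (zeta_baseVertex hs c') γb γ _

end HomotopySquare

/-! ### Homology and cohomology -/

section HomologySquares

universe u

variable (G : Type u) [AddCommGroup G] (k : ℕ)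

theorem homologyMap_homologyMap {X Y Z : Type} [TopologicalSpace X] [TopologicalSpace Y]
    [TopologicalSpace Z] (g : C(Y, Z)) (f : C(X, Y)) (x : Homology G k X) :
    homologyMap G k g (homologyMap G k f x) = homologyMap G k (g.comp f) x := by
  have h := (homologyFunctor G k).map_comp (TopCat.ofHom f) (TopCat.ofHom g)
  exact (congrArg (fun φ => φ.hom x) h).symm

theorem cohomologyMap_cohomologyMap {X Y Z : Type} [TopologicalSpace X] [TopologicalSpace Y]
    [TopologicalSpace Z] (g : C(Y, Z)) (f : C(X, Y)) (x : Cohomology G k Z) :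
    cohomologyMap G k f (cohomologyMap G k g x) = cohomologyMap G k (g.comp f) x := by
  have h := (cohomologyFunctor G k).map_comp (TopCat.ofHom g).op (TopCat.ofHom f).op
  exact (congrArg (fun φ => φ.hom x) h).symm

theorem homologyMap_square {X Y Y' Z : Type} [TopologicalSpace X] [TopologicalSpace Y]
    [TopologicalSpace Y'] [TopologicalSpace Z] {g : C(Y, Z)} {f : C(X, Y)} {g' : C(Y', Z)}
    {f' : C(X, Y')} (h : g.comp f = g'.comp f') (x : Homology G k X) :
    homologyMap G k g (homologyMap G k f x) = homologyMap G k g' (homologyMap G k f' x) := by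
  rw [homologyMap_homologyMap, homologyMap_homologyMap, h]

theorem cohomologyMap_square {X Y Y' Z : Type} [TopologicalSpace X] [TopologicalSpace Y]
    [TopologicalSpace Y'] [TopologicalSpace Z] {g : C(Y, Z)} {f : C(X, Y)} {g' : C(Y', Z)}
    {f' : C(X, Y')} (h : g.comp f = g'.comp f') (x : Cohomology G k Z) :
    cohomologyMap G k f (cohomologyMap G k g x) =
      cohomologyMap G k f' (cohomologyMap G k g' x) := by
  rw [cohomologyMap_cohomologyMap, cohomologyMap_cohomologyMap, h]

variable {G k}

/-- Any two radii are comparable, so monotone comparison is enough for independence of the radius.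
-/
theorem eq_of_radius_le {P : ℕ → Prop} {Q : Type u} {v : ∀ q, P q → Q}
    (hv : ∀ q q' (hq : P q) (hq' : P q'), q ≤ q' → v q' hq' = v q hq) {q q' : ℕ} (hq : P q)
    (hq' : P q') : v q hq = v q' hq' := by
  rcases le_total q q' with h | h
  · exact (hv q q' hq hq' h).symm
  · exact hv q' q hq' hq h

variable {A : Type} {D : ℕ} {S : Set (Config A D)} {R : ℕ} {a : Config A D}

theorem existsUnique_hom_invLim {ι : Type} [Preorder ι] {H : ι → Type u}
    [∀ i, AddCommGroup (H i)] {f : ∀ i j, i ≤ j → H j →+ H i} {L : Type u} [AddCommGroup L]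
    (φ : ∀ i, L →+ H i) (hφ : ∀ i j (h : i ≤ j) x, f i j h (φ j x) = φ i x) :
    ∃! F : L →+ invLim H f, ∀ x i, (F x).1 i = φ i x :=
  ⟨AddMonoidHom.mk' (fun x => ⟨fun i => φ i x, fun i j h => hφ i j h x⟩)
      fun x y => Subtype.ext (funext fun i => map_add (φ i) x y),
    fun _ _ => rfl, fun _ hF => AddMonoidHom.ext fun x => Subtype.ext (funext fun i => hF x i)⟩

theorem existsUnique_hom_directLimit {ι : Type} [Preorder ι] [DecidableEq ι] {H : ι → Type u}
    [∀ i, AddCommGroup (H i)] {f : ∀ i j, i ≤ j → H i →+ H j} {L : Type u} [AddCommGroup L]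
    (φ : ∀ i, H i →+ L) (hφ : ∀ i j (h : i ≤ j) x, φ j (f i j h x) = φ i x) :
    ∃! F : AddCommGroup.DirectLimit H f →+ L,
      ∀ i x, F (AddCommGroup.DirectLimit.of H f i x) = φ i x :=
  ⟨AddCommGroup.DirectLimit.lift H f L φ hφ,
    fun i x => AddCommGroup.DirectLimit.lift_of L φ hφ i x,
    fun _ hF => AddCommGroup.DirectLimit.hom_ext L fun i => AddMonoidHom.ext fun x =>
      (hF i x).trans (AddCommGroup.DirectLimit.lift_of L φ hφ i x).symm⟩

/-- A component of the inverse limit, followed by a homomorphism. -/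
def invLimProj {ι : Type} [Preorder ι] {H : ι → Type u} [∀ i, AddCommGroup (H i)]
    {f : ∀ i j, i ≤ j → H j →+ H i} {P : Type u} [AddCommGroup P] (i : ι) (φ : H i →+ P) :
    invLim H f →+ P :=
  φ.comp ((Pi.evalAddMonoidHom H i).comp (invLim H f).subtype)

theorem invLimProj_apply {ι : Type} [Preorder ι] {H : ι → Type u} [∀ i, AddCommGroup (H i)]
    {f : ∀ i j, i ≤ j → H j →+ H i} {P : Type u} [AddCommGroup P] (i : ι) (φ : H i →+ P)
    (x : invLim H f) : invLimProj i φ x = φ (x.1 i) := rfl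

theorem existsUnique_isHomologySignature :
    ∃! f : DefectHomology S R a G k →+ ShiftHomology S R G k, IsHomologySignature f := by
  refine existsUnique_hom_invLim
    (f := fun (r s : Set.Ici R) (h : r ≤ s) => homologyMap G k (zeta S h))
    (L := DefectHomology S R a G k) (fun r => invLimProj r (homologyMap G k (sec S a r)))
    fun r s h x => ?_
  rw [invLimProj_apply, invLimProj_apply, homologyMap_homologyMap, zeta_comp_sec,
    ← homologyMap_homologyMap]
  exact congrArg _ (x.2 r s h)

theorem existsUnique_isCohomologySignature :
    ∃! f : ShiftCohomology S R G k →+ DefectCohomology S R a G k, IsCohomologySignature f := by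
  refine existsUnique_hom_directLimit
    (fun r : Set.Ici R => (DefectCohomology.of S R a G k r).comp (cohomologyMap G k (sec S a r)))
    fun r s h x => ?_
  rw [AddMonoidHom.comp_apply, AddMonoidHom.comp_apply, cohomologyMap_cohomologyMap,
    zeta_comp_sec, ← cohomologyMap_cohomologyMap]
  exact AddCommGroup.DirectLimit.of_f _ _

/-! ### The effect of a cellular automaton on homology and cohomology -/

variable [TopologicalSpace A] {Φ : Config A D → Config A D} (hΦ : IsCellularAutomaton Φ)
  (hS : Set.MapsTo Φ S S)

theorem homologyMap_defectIncl_of_le {q q' : ℕ} (hq : HasRadius Φ q) (hq' : HasRadius Φ q')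
    (h : q ≤ q') (x : DefectHomology S R a G k) (r : Set.Ici R) :
    homologyMap G k (defectIncl hΦ hS hq' a r) (x.1 (addIdx r q')) =
      homologyMap G k (defectIncl hΦ hS hq a r) (x.1 (addIdx r q)) := by
  rw [defectIncl_eq_comp_unflawedIncl hΦ hS hq hq' h a r]
  refine (homologyMap_homologyMap G k _ _ _).symm.trans (congrArg _ ?_)
  exact x.2 (addIdx r q) (addIdx r q') (Nat.add_le_add_left h r.1)

theorem homologyMap_wangMap_of_le {q q' : ℕ} (hq : HasRadius Φ q) (hq' : HasRadius Φ q')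
    (h : q ≤ q') (x : ShiftHomology S R G k) (r : Set.Ici R) :
    homologyMap G k (wangMap hΦ hS hq' r) (x.1 (addIdx r q')) =
      homologyMap G k (wangMap hΦ hS hq r) (x.1 (addIdx r q)) := by
  rw [wangMap_eq_comp_zeta hΦ hS hq hq' h r]
  refine (homologyMap_homologyMap G k _ _ _).symm.trans (congrArg _ ?_)
  exact x.2 (addIdx r q) (addIdx r q') (Nat.add_le_add_left h r.1)

theorem cohomologyMap_defectIncl_of_le {q q' : ℕ} (hq : HasRadius Φ q) (hq' : HasRadius Φ q')
    (h : q ≤ q') (r : Set.Ici R) (x : Cohomology G k (Unflawed S (Φ a) r)) :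
    DefectCohomology.of S R a G k (addIdx r q')
        (cohomologyMap G k (defectIncl hΦ hS hq' a r) x) =
      DefectCohomology.of S R a G k (addIdx r q)
        (cohomologyMap G k (defectIncl hΦ hS hq a r) x) := by
  have hi : addIdx r q ≤ addIdx r q' := Nat.add_le_add_left h r.1
  rw [defectIncl_eq_comp_unflawedIncl hΦ hS hq hq' h a r]
  refine (congrArg _ (cohomologyMap_cohomologyMap G k _ _ _).symm).trans ?_
  exact AddCommGroup.DirectLimit.of_f hi _

theorem cohomologyMap_wangMap_of_le {q q' : ℕ} (hq : HasRadius Φ q) (hq' : HasRadius Φ q')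
    (h : q ≤ q') (r : Set.Ici R) (x : Cohomology G k (WangComplex S r)) :
    ShiftCohomology.of S R G k (addIdx r q') (cohomologyMap G k (wangMap hΦ hS hq' r) x) =
      ShiftCohomology.of S R G k (addIdx r q) (cohomologyMap G k (wangMap hΦ hS hq r) x) := by
  have hi : addIdx r q ≤ addIdx r q' := Nat.add_le_add_left h r.1
  rw [wangMap_eq_comp_zeta hΦ hS hq hq' h r]
  refine (congrArg _ (cohomologyMap_cohomologyMap G k _ _ _).symm).trans ?_
  exact AddCommGroup.DirectLimit.of_f hi _

/-- The map is built from one radius `q₀`; the condition for all other radii then follows by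
comparison, which also makes it equivalent to the condition for `q₀` alone. The next three results
have the same shape. -/
theorem existsUnique_isHomologyInclusion {q₀ : ℕ} (hq₀ : HasRadius Φ q₀) :
    ∃! f : DefectHomology S R a G k →+ DefectHomology S R (Φ a) G k,
      IsHomologyInclusion hΦ hS f := by
  have h := existsUnique_hom_invLim
    (f := fun (r s : Set.Ici R) (h : r ≤ s) => homologyMap G k (unflawedIncl S (Φ a) h))
    (L := DefectHomology S R a G k)
    (fun r => invLimProj (addIdx r q₀) (homologyMap G k (defectIncl hΦ hS hq₀ a r)))
    fun r s h x => by
      rw [invLimProj_apply, invLimProj_apply]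
      refine (homologyMap_square G k (unflawedIncl_comp_defectIncl hΦ hS hq₀ a h) _).trans (congrArg _ ?_)
      exact x.2 (addIdx r q₀) (addIdx s q₀) (Nat.add_le_add_right h q₀)
  refine (existsUnique_congr fun f => ⟨fun hf q hq x r => ?_, fun hf => hf q₀ hq₀⟩).1 h
  exact (hf x r).trans (eq_of_radius_le (fun _ _ hq hq' h =>
    homologyMap_defectIncl_of_le hΦ hS hq hq' h x r) hq₀ hq)

theorem existsUnique_isHomologyCAMap {q₀ : ℕ} (hq₀ : HasRadius Φ q₀) :
    ∃! f : ShiftHomology S R G k →+ ShiftHomology S R G k, IsHomologyCAMap hΦ hS f := by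
  have h := existsUnique_hom_invLim
    (f := fun (r s : Set.Ici R) (h : r ≤ s) => homologyMap G k (zeta S h))
    (L := ShiftHomology S R G k)
    (fun r => invLimProj (addIdx r q₀) (homologyMap G k (wangMap hΦ hS hq₀ r)))
    fun r s h x => by
      rw [invLimProj_apply, invLimProj_apply]
      refine (homologyMap_square G k (zeta_comp_wangMap hΦ hS hq₀ h) _).trans (congrArg _ ?_)
      exact x.2 (addIdx r q₀) (addIdx s q₀) (Nat.add_le_add_right h q₀)
  refine (existsUnique_congr fun f => ⟨fun hf q hq x r => ?_, fun hf => hf q₀ hq₀⟩).1 h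
  exact (hf x r).trans (eq_of_radius_le (fun _ _ hq hq' h =>
    homologyMap_wangMap_of_le hΦ hS hq hq' h x r) hq₀ hq)

theorem existsUnique_isCohomologyInclusion {q₀ : ℕ} (hq₀ : HasRadius Φ q₀) :
    ∃! f : DefectCohomology S R (Φ a) G k →+ DefectCohomology S R a G k,
      IsCohomologyInclusion hΦ hS f := by
  have h := existsUnique_hom_directLimit
    (f := fun (r s : Set.Ici R) (h : r ≤ s) => cohomologyMap G k (unflawedIncl S (Φ a) h))
    (fun r => (DefectCohomology.of S R a G k (addIdx r q₀)).comp
      (cohomologyMap G k (defectIncl hΦ hS hq₀ a r)))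
    fun r s h x => by
      have hi : addIdx r q₀ ≤ addIdx s q₀ := Nat.add_le_add_right h q₀
      rw [AddMonoidHom.comp_apply, AddMonoidHom.comp_apply]
      refine (congrArg _ (cohomologyMap_square G k (unflawedIncl_comp_defectIncl hΦ hS hq₀ a h) _)).trans ?_
      exact AddCommGroup.DirectLimit.of_f hi _
  refine (existsUnique_congr fun f => ⟨fun hf q hq r x => ?_, fun hf => hf q₀ hq₀⟩).1 h
  exact (hf r x).trans (eq_of_radius_le (fun _ _ hq hq' h =>
    cohomologyMap_defectIncl_of_le hΦ hS hq hq' h r x) hq₀ hq)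

theorem existsUnique_isCohomologyCAMap {q₀ : ℕ} (hq₀ : HasRadius Φ q₀) :
    ∃! f : ShiftCohomology S R G k →+ ShiftCohomology S R G k, IsCohomologyCAMap hΦ hS f := by
  have h := existsUnique_hom_directLimit
    (f := fun (r s : Set.Ici R) (h : r ≤ s) => cohomologyMap G k (zeta S h))
    (fun r => (ShiftCohomology.of S R G k (addIdx r q₀)).comp
      (cohomologyMap G k (wangMap hΦ hS hq₀ r)))
    fun r s h x => by
      have hi : addIdx r q₀ ≤ addIdx s q₀ := Nat.add_le_add_right h q₀
      rw [AddMonoidHom.comp_apply, AddMonoidHom.comp_apply]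
      refine (congrArg _ (cohomologyMap_square G k (zeta_comp_wangMap hΦ hS hq₀ h) _)).trans ?_
      exact AddCommGroup.DirectLimit.of_f hi _
  refine (existsUnique_congr fun f => ⟨fun hf q hq r x => ?_, fun hf => hf q₀ hq₀⟩).1 h
  exact (hf r x).trans (eq_of_radius_le (fun _ _ hq hq' h =>
    cohomologyMap_wangMap_of_le hΦ hS hq hq' h r x) hq₀ hq)

variable {hΦ hS}

theorem homology_square {q : ℕ} (hq : HasRadius Φ q)
    {Ha : DefectHomology S R a G k →+ ShiftHomology S R G k}
    {Hb : DefectHomology S R (Φ a) G k →+ ShiftHomology S R G k}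
    {Hι : DefectHomology S R a G k →+ DefectHomology S R (Φ a) G k}
    {HΦ : ShiftHomology S R G k →+ ShiftHomology S R G k}
    (ha : IsHomologySignature Ha) (hb : IsHomologySignature Hb)
    (hι : IsHomologyInclusion hΦ hS Hι) (hc : IsHomologyCAMap hΦ hS HΦ) :
    Hb.comp Hι = HΦ.comp Ha := by
  refine AddMonoidHom.ext fun x => Subtype.ext (funext fun r => ?_)
  rw [AddMonoidHom.comp_apply, AddMonoidHom.comp_apply, hb, hι q hq, hc q hq, ha]
  exact homologyMap_square G k (sec_comp_defectIncl hΦ hS hq a r) _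

theorem cohomology_square {q : ℕ} (hq : HasRadius Φ q)
    {Ha : ShiftCohomology S R G k →+ DefectCohomology S R a G k}
    {Hb : ShiftCohomology S R G k →+ DefectCohomology S R (Φ a) G k}
    {Hι : DefectCohomology S R (Φ a) G k →+ DefectCohomology S R a G k}
    {HΦ : ShiftCohomology S R G k →+ ShiftCohomology S R G k}
    (ha : IsCohomologySignature Ha) (hb : IsCohomologySignature Hb)
    (hι : IsCohomologyInclusion hΦ hS Hι) (hc : IsCohomologyCAMap hΦ hS HΦ) :
    Hι.comp Hb = Ha.comp HΦ := by
  -- A homomorphism out of a direct limit is tested on each stage, where the square is the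
  -- contravariant image of `sec_comp_defectIncl`.
  refine AddCommGroup.DirectLimit.hom_ext _ fun r => AddMonoidHom.ext fun x => ?_
  refine (congrArg Hι (hb r x)).trans (Eq.trans ?_ (congrArg Ha (hc q hq r x)).symm)
  refine (hι q hq r _).trans (Eq.trans ?_ (ha (addIdx r q) _).symm)
  exact congrArg _ (cohomologyMap_square G k (sec_comp_defectIncl hΦ hS hq a r) _)

end HomologySquares

end DefectSignature

end

theorem theorem3p3 {A : Type} [Finite A] [TopologicalSpace A] [DiscreteTopology A] {D : ℕ}
    (S : Set (DefectSignature.Config A D)) (R : ℕ) (hS : DefectSignature.IsSFT S R)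
    (a : DefectSignature.Config A D) (k : ℕ) :
    -- (a): the homology and cohomology signatures
    (∀ (G : Type*) [AddCommGroup G],
      (∃! f : DefectSignature.DefectHomology S R a G k →+ DefectSignature.ShiftHomology S R G k,
        DefectSignature.IsHomologySignature f) ∧
      (∃! f : DefectSignature.ShiftCohomology S R G k →+
          DefectSignature.DefectCohomology S R a G k,
        DefectSignature.IsCohomologySignature f)) ∧
    -- (b): the homotopy signature
    (∀ [NeZero k], DefectSignature.BasepointFree S R k →
      ∀ (ω : NNReal → Fin D → ℝ) (hω : DefectSignature.IsBaseRay S a ω) (c : S),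
        ∃! f : DefectSignature.DefectHomotopy S R a k hω.continuous →*
            DefectSignature.ShiftHomotopy S R k c,
          DefectSignature.IsHomotopySignature c f) ∧
    -- (c): the commuting squares for a cellular automaton
    (∀ (Φ : DefectSignature.Config A D → DefectSignature.Config A D)
      (hΦ : DefectSignature.IsCellularAutomaton Φ) (hΦS : Set.MapsTo Φ S S),
      -- homology and cohomology
      (∀ (G : Type*) [AddCommGroup G],
        (∃! f : DefectSignature.DefectHomology S R a G k →+
            DefectSignature.DefectHomology S R (Φ a) G k,
          DefectSignature.IsHomologyInclusion hΦ hΦS f) ∧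
        (∃! f : DefectSignature.ShiftHomology S R G k →+ DefectSignature.ShiftHomology S R G k,
          DefectSignature.IsHomologyCAMap hΦ hΦS f) ∧
        (∀ (Ha : DefectSignature.DefectHomology S R a G k →+
              DefectSignature.ShiftHomology S R G k)
            (Hb : DefectSignature.DefectHomology S R (Φ a) G k →+
              DefectSignature.ShiftHomology S R G k)
            (Hι : DefectSignature.DefectHomology S R a G k →+
              DefectSignature.DefectHomology S R (Φ a) G k)
            (HΦ : DefectSignature.ShiftHomology S R G k →+
              DefectSignature.ShiftHomology S R G k),
          DefectSignature.IsHomologySignature Ha → DefectSignature.IsHomologySignature Hb →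
          DefectSignature.IsHomologyInclusion hΦ hΦS Hι →
          DefectSignature.IsHomologyCAMap hΦ hΦS HΦ →
            Hb.comp Hι = HΦ.comp Ha) ∧
        (∃! f : DefectSignature.DefectCohomology S R (Φ a) G k →+
            DefectSignature.DefectCohomology S R a G k,
          DefectSignature.IsCohomologyInclusion hΦ hΦS f) ∧
        (∃! f : DefectSignature.ShiftCohomology S R G k →+
            DefectSignature.ShiftCohomology S R G k,
          DefectSignature.IsCohomologyCAMap hΦ hΦS f) ∧
        (∀ (Ha : DefectSignature.ShiftCohomology S R G k →+
              DefectSignature.DefectCohomology S R a G k)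
            (Hb : DefectSignature.ShiftCohomology S R G k →+
              DefectSignature.DefectCohomology S R (Φ a) G k)
            (Hι : DefectSignature.DefectCohomology S R (Φ a) G k →+
              DefectSignature.DefectCohomology S R a G k)
            (HΦ : DefectSignature.ShiftCohomology S R G k →+
              DefectSignature.ShiftCohomology S R G k),
          DefectSignature.IsCohomologySignature Ha → DefectSignature.IsCohomologySignature Hb →
          DefectSignature.IsCohomologyInclusion hΦ hΦS Hι →
          DefectSignature.IsCohomologyCAMap hΦ hΦS HΦ →
            Hι.comp Hb = Ha.comp HΦ)) ∧
      -- homotopy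
      (∀ [NeZero k], DefectSignature.BasepointFree S R k →
        ∀ (ω : NNReal → Fin D → ℝ) (hω : DefectSignature.IsBaseRay S a ω),
          DefectSignature.IsBaseRay S (Φ a) ω ∧
          (∃! f : DefectSignature.DefectHomotopy S R a k hω.continuous →*
              DefectSignature.DefectHomotopy S R (Φ a) k hω.continuous,
            DefectSignature.IsHomotopyInclusion hΦ hΦS f) ∧
          ∀ c c' : S,
            (∃! f : DefectSignature.ShiftHomotopy S R k c →* DefectSignature.ShiftHomotopy S R k c',
              DefectSignature.IsHomotopyCAMap hΦ hΦS c c' f) ∧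
            (∀ (πa : DefectSignature.DefectHomotopy S R a k hω.continuous →*
                  DefectSignature.ShiftHomotopy S R k c)
                (πb : DefectSignature.DefectHomotopy S R (Φ a) k hω.continuous →*
                  DefectSignature.ShiftHomotopy S R k c')
                (πι : DefectSignature.DefectHomotopy S R a k hω.continuous →*
                  DefectSignature.DefectHomotopy S R (Φ a) k hω.continuous)
                (πΦ : DefectSignature.ShiftHomotopy S R k c →*
                  DefectSignature.ShiftHomotopy S R k c'),
              DefectSignature.IsHomotopySignature c πa →
              DefectSignature.IsHomotopySignature c' πb →
              DefectSignature.IsHomotopyInclusion hΦ hΦS πι →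
              DefectSignature.IsHomotopyCAMap hΦ hΦS c c' πΦ →
                πb.comp πι = πΦ.comp πa))) := by
  refine ⟨fun G _ => ⟨DefectSignature.existsUnique_isHomologySignature,
    DefectSignature.existsUnique_isCohomologySignature⟩, fun hB ω hω c =>
    DefectSignature.existsUnique_isHomotopySignature (hB.pathConnectedSpace hS c)
      (hB.eventually_actsTrivially hS c) hω c, fun Φ hΦ hΦS => ?_⟩
  -- The conditions on induced maps quantify over all radii of `Φ`; without at least one radius they
  -- would be empty and uniqueness would have nothing to rest on.
  obtain ⟨q, hq⟩ := hΦ.exists_hasRadius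
  refine ⟨fun G _ => ⟨DefectSignature.existsUnique_isHomologyInclusion hΦ hΦS hq,
    DefectSignature.existsUnique_isHomologyCAMap hΦ hΦS hq,
    fun _ _ _ _ => DefectSignature.homology_square hq,
    DefectSignature.existsUnique_isCohomologyInclusion hΦ hΦS hq,
    DefectSignature.existsUnique_isCohomologyCAMap hΦ hΦS hq,
    fun _ _ _ _ => DefectSignature.cohomology_square hq⟩, fun hB ω hω => ?_⟩
  refine ⟨hω.image hΦ hΦS hq, DefectSignature.existsUnique_isHomotopyInclusion hΦ hΦS hq hω,
    fun c c' => ⟨?_, fun _ _ _ _ => ?_⟩⟩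
  · exact DefectSignature.existsUnique_isHomotopyCAMap hΦ hΦS (hB.pathConnectedSpace hS c)
      (hB.eventually_actsTrivially hS c) hq c c'
  · exact DefectSignature.homotopy_square (hB.pathConnectedSpace hS c)
      (hB.eventually_actsTrivially hS c) hq hω
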